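/- Let $H^L(x,y)=\frac{b_L}{2}y^2-\frac{c_L}{2}x^2+a_Lxy+a_Ly-\beta_Lx$, $H^C(x,y)=\frac12x^2+\frac12y^2$ and $H^R(x,y)=\frac{b_R}{2}y^2-\frac{c_R}{2}x^2+a_Rxy-a_Ry-\beta_Rx$, where $$a_L=b_R=1,\quad \beta_L=-3,\quad b_L=2,\quad c_L=c_R=-1,\quad a_R=\beta_R=0,$$ and consider, for $\epsilon\ge 0$, the discontinuous piecewise linear near-Hamiltonian system $$\dot x=H_y+\epsilon f,\qquad \dot y=-H_x+\epsilon g,$$ where $(H,f,g)=(H^L,f_L,g_L)$ for $x\le -1$, $(H^C,f_C,g_C)$ for $-1\le x\le 1$ and $(H^R,f_R,g_R)$ for $x\ge 1$, with $f_i(x,y)=p_ix+q_iy+r_i$ and $g_i(x,y)=s_ix+u_iy+v_i$ for $i=L,C,R$. For $\epsilon=0$ the left and the central subsystems have real centers (lying in the open regions $x<-1$ and $-1<x<1$, respectively), the right subsystem has a virtual center (lying outside the region $x>1$), and for every $h>0$ the closed curve $$\begin{aligned}L_h=\ &\{x>1,\ H^R(x,y)=H^R(1,h)\}\cup\{-1\le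 x\le 1,\ y<0,\ H^C(x,y)=H^C(1,-h)\}\\ &\cup\{x<-1,\ H^L(x,y)=H^L(-1,-h)\}\cup\{-1\le x\le 1,\ y>0,\ H^C(x,y)=H^C(-1,h)\}\end{aligned}$$ is a crossing periodic orbit that visits all three zones; that is, it is a periodic orbit which meets the lines $x=\pm1$ only at points where the horizontal components of the two adjacent vector fields are nonzero and of the same sign. At least three limit cycles bifurcate from this periodic annulus for small $\epsilon>0$: there are real coefficients $p_i,q_i,r_i,s_i,u_i,v_i$ $(i=L,C,R)$ and three distinct numbers $h_1,h_2,h_3>0$ such that for every $\eta>0$ there is $\epsilon_0>0$ such that for all $0<\epsilon<\epsilon_0$ the system has three distinct crossing limit cycles (isolated crossing periodic orbits) $\Gamma_1,\Gamma_2,\Gamma_3$, each visiting all three zones, where $\Gamma_j$ lies in the $\eta$-neighbourhood of $L_{h_j}$ and $L_{h_j}$ lies in the $\eta$-neighbourhood of $\Gamma_j$ for $j=1,2,3$. -/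

import Mathlib

open Set

/-- The three zones of the plane cut out by the lines `x = -1` and `x = 1`. -/
inductive PWZone where
  | L
  | C
  | R

/-- The open regions `x < -1`, `-1 < x < 1` and `x > 1`. -/
def PWZone.region : PWZone → Set (ℝ × ℝ)
  | .L => {p | p.1 < -1}
  | .C => {p | -1 < p.1 ∧ p.1 < 1}
  | .R => {p | 1 < p.1}

/-- Coefficients of a quadratic Hamiltonian
`(b/2) y² - (c/2) x² + a x y + α y - β x`. -/
structure QuadHam where
  b : ℝ
  c : ℝ
  a : ℝ
  α : ℝ
  β : ℝ

/-- The quadratic Hamiltonian function. -/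
noncomputable def QuadHam.eval (H : QuadHam) (x y : ℝ) : ℝ :=
  H.b / 2 * y ^ 2 - H.c / 2 * x ^ 2 + H.a * x * y + H.α * y - H.β * x

/-- Coefficients of an affine perturbation
`f(x,y) = p x + q y + r`, `g(x,y) = s x + u y + v`. -/
structure AffPert where
  p : ℝ
  q : ℝ
  r : ℝ
  s : ℝ
  u : ℝ
  v : ℝ

/-- First component of the perturbation. -/
def AffPert.f (P : AffPert) (x y : ℝ) : ℝ := P.p * x + P.q * y + P.r

/-- Second component of the perturbation. -/
def AffPert.g (P : AffPert) (x y : ℝ) : ℝ := P.s * x + P.u * y + P.v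

/-- The near-Hamiltonian vector field `(H_y + ε f, -H_x + ε g)` of each of the three subsystems
(each one regarded as a vector field on the whole plane). -/
noncomputable def nearHamField (H : PWZone → QuadHam) (P : PWZone → AffPert) (ε : ℝ)
    (z : PWZone) (p : ℝ × ℝ) : ℝ × ℝ :=
  (deriv (fun y => (H z).eval p.1 y) p.2 + ε * (P z).f p.1 p.2,
   -deriv (fun x => (H z).eval x p.2) p.1 + ε * (P z).g p.1 p.2)

/-- Explicit form of the vector field. -/
theorem nearHamField_eq (H : PWZone → QuadHam) (P : PWZone → AffPert) (ε : ℝ)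
    (z : PWZone) (p : ℝ × ℝ) :
    nearHamField H P ε z p =
      ((H z).a * p.1 + (H z).b * p.2 + (H z).α
          + ε * ((P z).p * p.1 + (P z).q * p.2 + (P z).r),
        (H z).c * p.1 - (H z).a * p.2 + (H z).β
          + ε * ((P z).s * p.1 + (P z).u * p.2 + (P z).v)) := by
  have h1 : HasDerivAt (fun y => (H z).eval p.1 y)
      ((H z).a * p.1 + (H z).b * p.2 + (H z).α) p.2 := by
    have h := (((((hasDerivAt_pow 2 p.2).const_mul ((H z).b / 2)).sub_const
      ((H z).c / 2 * p.1 ^ 2)).add ((hasDerivAt_id p.2).const_mul ((H z).a * p.1))).add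
      ((hasDerivAt_id p.2).const_mul (H z).α)).sub_const ((H z).β * p.1)
    refine h.congr_deriv ?_
    norm_num
    ring
  have h2 : HasDerivAt (fun x => (H z).eval x p.2)
      (-((H z).c * p.1 - (H z).a * p.2 + (H z).β)) p.1 := by
    have h := (((((hasDerivAt_pow 2 p.1).const_mul ((H z).c / 2)).const_sub
      ((H z).b / 2 * p.2 ^ 2)).add
        (((hasDerivAt_id p.1).const_mul (H z).a).mul_const p.2)).add_const
      ((H z).α * p.2)).sub ((hasDerivAt_id p.1).const_mul (H z).β)
    refine h.congr_deriv ?_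
    norm_num
    ring
  simp only [nearHamField, h1.deriv, h2.deriv, neg_neg, AffPert.f, AffPert.g]

/-- The normal form: `H^C = x²/2 + y²/2`, `α_L = a_L` and `α_R = -a_R`. -/
def normalForm (aL bL cL βL aR bR cR βR : ℝ) : PWZone → QuadHam
  | .L => { b := bL, c := cL, a := aL, α := aL, β := βL }
  | .C => { b := 1, c := -1, a := 0, α := 0, β := 0 }
  | .R => { b := bR, c := cR, a := aR, α := -aR, β := βR }

/-- At time `t` the curve `γ` crosses a switching line that has zone `A` on its left and zone `B`
on its right: the horizontal components of both vector fields at `γ t` are nonzero and of the same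
sign, and `γ` passes from the orbit of one field to the orbit of the other. -/
def CrossesAt (X : PWZone → ℝ × ℝ → ℝ × ℝ) (A B : PWZone) (γ : ℝ → ℝ × ℝ) (t : ℝ) : Prop :=
  (0 < (X A (γ t)).1 ∧ 0 < (X B (γ t)).1 ∧
      HasDerivWithinAt γ (X A (γ t)) (Iic t) t ∧ HasDerivWithinAt γ (X B (γ t)) (Ici t) t) ∨
  ((X A (γ t)).1 < 0 ∧ (X B (γ t)).1 < 0 ∧
      HasDerivWithinAt γ (X B (γ t)) (Iic t) t ∧ HasDerivWithinAt γ (X A (γ t)) (Ici t) t)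

/-- Crossing solutions of the piecewise system, defined for all times: in each open zone the
curve solves the corresponding subsystem, and it meets the lines `x = ±1` only at crossing
points. -/
structure IsCrossingSolution (X : PWZone → ℝ × ℝ → ℝ × ℝ) (γ : ℝ → ℝ × ℝ) : Prop where
  inside : ∀ z t, γ t ∈ z.region → HasDerivAt γ (X z (γ t)) t
  left : ∀ t, (γ t).1 = -1 → CrossesAt X .L .C γ t
  right : ∀ t, (γ t).1 = 1 → CrossesAt X .C .R γ t

/-- `Γ` is a crossing periodic orbit (the image of a nonconstant periodic crossing solution). -/
def IsCrossingPeriodicOrbit (X : PWZone → ℝ × ℝ → ℝ × ℝ) (Γ : Set (ℝ × ℝ)) : Prop :=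
  ∃ (γ : ℝ → ℝ × ℝ) (T : ℝ), IsCrossingSolution X γ ∧ 0 < T ∧ Function.Periodic γ T ∧
    (∃ t, γ t ≠ γ 0) ∧ range γ = Γ

/-- A crossing limit cycle: a crossing periodic orbit that is isolated among the periodic orbits.
(A small neighbourhood of a crossing periodic orbit meets the switching lines only in crossing
points, so only crossing orbits have to be considered for the isolation.) -/
def IsCrossingLimitCycle (X : PWZone → ℝ × ℝ → ℝ × ℝ) (Γ : Set (ℝ × ℝ)) : Prop :=
  IsCrossingPeriodicOrbit X Γ ∧
    ∃ U : Set (ℝ × ℝ), IsOpen U ∧ Γ ⊆ U ∧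
      ∀ Γ' : Set (ℝ × ℝ), IsCrossingPeriodicOrbit X Γ' → Γ' ⊆ U → Γ' = Γ

/-- `Γ` visits the three open zones. -/
def VisitsAllZones (Γ : Set (ℝ × ℝ)) : Prop :=
  ∀ z : PWZone, (Γ ∩ z.region).Nonempty

/-- `p` is a center of the planar vector field `Y`: an equilibrium with a punctured neighbourhood
filled with periodic orbits. -/
def IsCenterAt (Y : ℝ × ℝ → ℝ × ℝ) (p : ℝ × ℝ) : Prop :=
  Y p = 0 ∧ ∃ U : Set (ℝ × ℝ), IsOpen U ∧ p ∈ U ∧ ∀ q ∈ U, q ≠ p →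
    ∃ (γ : ℝ → ℝ × ℝ) (T : ℝ), (∀ t, HasDerivAt γ (Y (γ t)) t) ∧ γ 0 = q ∧
      0 < T ∧ Function.Periodic γ T ∧ ∃ t, γ t ≠ γ 0

/-- The subsystem of zone `z` has a center that lies in its open zone. -/
def HasRealCenter (X : PWZone → ℝ × ℝ → ℝ × ℝ) (z : PWZone) : Prop :=
  ∃ p, IsCenterAt (X z) p ∧ p ∈ z.region

/-- The subsystem of zone `z` has a center that lies outside its open zone. -/
def HasVirtualCenter (X : PWZone → ℝ × ℝ → ℝ × ℝ) (z : PWZone) : Prop :=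
  ∃ p, IsCenterAt (X z) p ∧ p ∉ z.region

/-- The closed curve `L_h` through `(1,h)`, `(1,-h)`, `(-1,-h)` and `(-1,h)`, composed of arcs of
level curves of `H^R`, `H^C` and `H^L`. -/
def annulusOrbit (H : PWZone → QuadHam) (h : ℝ) : Set (ℝ × ℝ) :=
  {p | 1 < p.1 ∧ (H .R).eval p.1 p.2 = (H .R).eval 1 h} ∪
  {p | -1 ≤ p.1 ∧ p.1 ≤ 1 ∧ p.2 < 0 ∧ (H .C).eval p.1 p.2 = (H .C).eval 1 (-h)} ∪
  {p | p.1 < -1 ∧ (H .L).eval p.1 p.2 = (H .L).eval (-1) (-h)} ∪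
  {p | -1 ≤ p.1 ∧ p.1 ≤ 1 ∧ 0 < p.2 ∧ (H .C).eval p.1 p.2 = (H .C).eval (-1) h}

/-!
The perturbation is chosen so that every subsystem stays explicitly solvable. In suitable affine
coordinates the left subsystem is a focus around `(-5, 2)` with expansion rate `k = ε q`, the
central one a focus around the origin with rate `m = ε p`, and the right one a rotation around
`(0, -s)` with `s = ε r`; all three turn clockwise with unit angular speed (`focusField`,
`nearHamField_focusPert`). An orbit that visits the three zones and crosses the lines `x = ±1` at
`(1, a)`, `(1, -b)`, `(-1, -2 c)`, `(-1, 2 d)` is therefore described by four elementary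
equations: `b = a + 2 s`, and three equations that compare the radii at both ends of a spiral arc
with the exponential of the angle it sweeps (`IsTurn`, `IsLoop`). Conversely every solution of
these equations is realized by a crossing periodic orbit, whose four arcs are glued in
`exists_periodic_of_zoneArcs`. For `ε = 0` the loops are the curves `L_h`
(`annulusOrbit_eq_loopSet`).

To first order in `ε` the closing equations reduce to the vanishing of
`M(h) = r h + p (1 + h²) (π - 2 arctan h) + q (4 + h²) (π - arctan (h / 2))`.
After the substitution `2 c = a + ε γ`, `2 d = a + ε δ` they are divisible by `ε`, the quotient is
continuously differentiable up to `ε = 0`, and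
its linearization in `(a, γ, δ)` is invertible at a simple zero of `M`. The inverse function
theorem continues each simple zero to a branch of loops, which are locally unique for fixed `ε`
(`exists_branch`). For `q = 5`, `p = -21`, `r = -5` the function `M` changes sign three times on
the positive axis and has a positive third derivative, so that by Rolle's theorem its three zeros
are simple (`exists_three_zeros_melnikov`).

A locally unique loop is a limit cycle (`IsLoop.isCrossingLimitCycle`). A periodic orbit close to
the loop has to meet the switching lines, because no subsystem has a periodic orbit inside its own
zone when `k` and `m` do not vanish. By uniqueness of solutions it then follows explicit arcs, and
its crossings of the line `x = 1` form a compact set on which the first return map is monotone.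
Such a map has a fixed point, the corner of a loop near the given one, hence of the given loop
itself.
-/

open Filter Topology

/-! ### Spiral flows -/

/-- The flow of the linear focus `x' = y + k x`, `y' = -x + k y` (a clockwise rotation of unit
angular speed, expanded at rate `k`), at time `t` and with initial point `p`. -/
noncomputable def spiral (k : ℝ) (p : ℝ × ℝ) (t : ℝ) : ℝ × ℝ :=
  (Real.exp (k * t) * (Real.cos t * p.1 + Real.sin t * p.2),
    Real.exp (k * t) * (Real.cos t * p.2 - Real.sin t * p.1))

theorem spiral_zero (k : ℝ) (p : ℝ × ℝ) : spiral k p 0 = p := by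
  simp [spiral]

theorem hasDerivAt_spiral_fst (k : ℝ) (p : ℝ × ℝ) (t : ℝ) :
    HasDerivAt (fun t => (spiral k p t).1) ((spiral k p t).2 + k * (spiral k p t).1) t := by
  have h1 : HasDerivAt (fun t : ℝ => Real.exp (k * t)) (Real.exp (k * t) * k) t := by
    simpa using ((hasDerivAt_id t).const_mul k).exp
  have h := h1.mul (((Real.hasDerivAt_cos t).mul_const p.1).add
    ((Real.hasDerivAt_sin t).mul_const p.2))
  refine h.congr_deriv ?_
  simp only [spiral, Pi.add_apply]
  ring

theorem hasDerivAt_spiral_snd (k : ℝ) (p : ℝ × ℝ) (t : ℝ) :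
    HasDerivAt (fun t => (spiral k p t).2) (-(spiral k p t).1 + k * (spiral k p t).2) t := by
  have h1 : HasDerivAt (fun t : ℝ => Real.exp (k * t)) (Real.exp (k * t) * k) t := by
    simpa using ((hasDerivAt_id t).const_mul k).exp
  have h := h1.mul (((Real.hasDerivAt_cos t).mul_const p.2).sub
    ((Real.hasDerivAt_sin t).mul_const p.1))
  refine h.congr_deriv ?_
  simp only [spiral, Pi.sub_apply]
  ring

/-- A spiral in polar form; the initial point `(X, -X β)` has clockwise angle `arctan β`. -/
theorem spiral_polar (k X β t : ℝ) :
    spiral k (X, -(X * β)) t =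
      (Real.exp (k * t) * (X * √(1 + β ^ 2)) * Real.cos (t + Real.arctan β),
        -(Real.exp (k * t) * (X * √(1 + β ^ 2)) * Real.sin (t + Real.arctan β))) := by
  have hs : √(1 + β ^ 2) ≠ 0 := (Real.sqrt_pos.2 (by positivity)).ne'
  simp only [spiral, Real.cos_add, Real.sin_add, Real.cos_arctan, Real.sin_arctan]
  ext
  · field_simp
    ring
  · field_simp
    ring

theorem hasDerivAt_exp_mul_cos (k φ : ℝ) :
    HasDerivAt (fun φ => Real.exp (k * φ) * Real.cos φ)
      (Real.exp (k * φ) * (√(1 + k ^ 2) * Real.sin (Real.arctan k - φ))) φ := by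
  have h1 : HasDerivAt (fun t : ℝ => Real.exp (k * t)) (Real.exp (k * φ) * k) φ := by
    simpa using ((hasDerivAt_id φ).const_mul k).exp
  refine (h1.mul (Real.hasDerivAt_cos φ)).congr_deriv ?_
  have hs : √(1 + k ^ 2) ≠ 0 := (Real.sqrt_pos.2 (by positivity)).ne'
  rw [Real.sin_sub, Real.cos_arctan, Real.sin_arctan]
  field_simp
  ring

theorem strictAntiOn_exp_mul_cos (k : ℝ) :
    StrictAntiOn (fun φ => Real.exp (k * φ) * Real.cos φ)
      (Icc (Real.arctan k) (Real.arctan k + Real.pi)) := by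
  refine strictAntiOn_of_deriv_neg (convex_Icc _ _)
    (fun φ _ => (hasDerivAt_exp_mul_cos k φ).continuousAt.continuousWithinAt) fun φ hφ => ?_
  rw [interior_Icc] at hφ
  rw [(hasDerivAt_exp_mul_cos k φ).deriv]
  have hs : 0 < √(1 + k ^ 2) := Real.sqrt_pos.2 (by positivity)
  have : Real.sin (Real.arctan k - φ) < 0 :=
    Real.sin_neg_of_neg_of_neg_pi_lt (by linarith [hφ.1]) (by linarith [hφ.2])
  exact mul_neg_of_pos_of_neg (Real.exp_pos _) (mul_neg_of_pos_of_neg hs this)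

theorem strictMonoOn_exp_mul_cos (k : ℝ) :
    StrictMonoOn (fun φ => Real.exp (k * φ) * Real.cos φ)
      (Icc (Real.arctan k + Real.pi) (Real.arctan k + 2 * Real.pi)) := by
  refine strictMonoOn_of_deriv_pos (convex_Icc _ _)
    (fun φ _ => (hasDerivAt_exp_mul_cos k φ).continuousAt.continuousWithinAt) fun φ hφ => ?_
  rw [interior_Icc] at hφ
  rw [(hasDerivAt_exp_mul_cos k φ).deriv]
  have hs : 0 < √(1 + k ^ 2) := Real.sqrt_pos.2 (by positivity)
  have : 0 < Real.sin (Real.arctan k - φ) := by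
    rw [← Real.sin_add_two_pi]
    exact Real.sin_pos_of_pos_of_lt_pi (by linarith [hφ.2]) (by linarith [hφ.1])
  exact mul_pos (Real.exp_pos _) (mul_pos hs this)

/-- The first coordinate of a spiral is a positive multiple of `exp (k φ) cos φ`, where `φ` is the
clockwise angle. -/
theorem spiral_fst_eq (k X β t : ℝ) :
    (spiral k (X, -(X * β)) t).1 = X * √(1 + β ^ 2) * Real.exp (-(k * Real.arctan β)) *
      (Real.exp (k * (t + Real.arctan β)) * Real.cos (t + Real.arctan β)) := by
  rw [spiral_polar]
  have : Real.exp (k * t) =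
      Real.exp (-(k * Real.arctan β)) * Real.exp (k * (t + Real.arctan β)) := by
    rw [← Real.exp_add]
    ring_nf
  simp only
  rw [this]
  ring

theorem exp_mul_sqrt_eq {k t β χ : ℝ} (h : 1 + χ ^ 2 = (1 + β ^ 2) * Real.exp (2 * k * t)) :
    Real.exp (k * t) * √(1 + β ^ 2) = √(1 + χ ^ 2) := by
  rw [h, Real.sqrt_mul (by positivity), mul_comm]
  congr 1
  rw [show 2 * k * t = k * t + k * t by ring, Real.exp_add, Real.sqrt_mul_self (Real.exp_pos _).le]

/-- Half-turn transition: end point of a spiral from `(X, -X β)` to the opposite vertical line. -/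
theorem spiral_halfTurn {k X β χ : ℝ}
    (h : 1 + χ ^ 2 = (1 + β ^ 2) *
      Real.exp (2 * k * (Real.pi - Real.arctan β - Real.arctan χ))) :
    spiral k (X, -(X * β)) (Real.pi - Real.arctan β - Real.arctan χ) = (-X, -(X * χ)) := by
  have hs : √(1 + χ ^ 2) ≠ 0 := (Real.sqrt_pos.2 (by positivity)).ne'
  rw [spiral_polar, show Real.pi - Real.arctan β - Real.arctan χ + Real.arctan β =
    Real.pi - Real.arctan χ by ring, Real.cos_pi_sub, Real.sin_pi_sub, Real.cos_arctan,
    Real.sin_arctan, mul_left_comm, exp_mul_sqrt_eq h]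
  ext
  · field_simp
  · field_simp

/-- Full-turn transition: end point of a spiral from `(X, -X β)` back to its vertical line. -/
theorem spiral_fullTurn {k X β χ : ℝ}
    (h : 1 + χ ^ 2 = (1 + β ^ 2) *
      Real.exp (2 * k * (2 * Real.pi - Real.arctan β - Real.arctan χ))) :
    spiral k (X, -(X * β)) (2 * Real.pi - Real.arctan β - Real.arctan χ) = (X, X * χ) := by
  have hs : √(1 + χ ^ 2) ≠ 0 := (Real.sqrt_pos.2 (by positivity)).ne'
  rw [spiral_polar, show 2 * Real.pi - Real.arctan β - Real.arctan χ + Real.arctan β =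
    2 * Real.pi - Real.arctan χ by ring, Real.cos_two_pi_sub, Real.sin_two_pi_sub,
    Real.cos_arctan, Real.sin_arctan, mul_left_comm, exp_mul_sqrt_eq h]
  ext
  · field_simp
  · field_simp

/-- A rotation from `(X, X α)` back to its vertical line through `x > X`. -/
theorem spiral_shortTurn (X α : ℝ) :
    spiral 0 (X, X * α) (2 * Real.arctan α) = (X, -(X * α)) := by
  have hs : √(1 + α ^ 2) ≠ 0 := (Real.sqrt_pos.2 (by positivity)).ne'
  have h := spiral_polar 0 X (-α) (2 * Real.arctan α)
  rw [show -(X * -α) = X * α by ring, Real.arctan_neg, show 2 * Real.arctan α + -Real.arctan α =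
    Real.arctan α by ring, Real.cos_arctan, Real.sin_arctan] at h
  rw [h]
  ext
  · simp; field_simp
  · simp; field_simp

theorem spiral_halfTurn_fst_mem {k X β χ t : ℝ} (hX : 0 < X) (hβ : |k| ≤ β) (hχ : |k| ≤ χ)
    (h : 1 + χ ^ 2 = (1 + β ^ 2) *
      Real.exp (2 * k * (Real.pi - Real.arctan β - Real.arctan χ)))
    (ht : t ∈ Ioo 0 (Real.pi - Real.arctan β - Real.arctan χ)) :
    -X < (spiral k (X, -(X * β)) t).1 ∧ (spiral k (X, -(X * β)) t).1 < X := by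
  have hk1 : Real.arctan k ≤ Real.arctan β := Real.arctan_mono ((le_abs_self k).trans hβ)
  have hk2 : -Real.arctan χ ≤ Real.arctan k := by
    rw [← Real.arctan_neg]
    exact Real.arctan_mono (by linarith [neg_abs_le k])
  have hc : 0 < X * √(1 + β ^ 2) * Real.exp (-(k * Real.arctan β)) :=
    mul_pos (mul_pos hX (Real.sqrt_pos.2 (by positivity))) (Real.exp_pos _)
  obtain ⟨h1, h2⟩ := ht
  constructor
  · have he := congrArg Prod.fst (spiral_halfTurn (X := X) h)
    simp only at he
    rw [← he, spiral_fst_eq, spiral_fst_eq]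
    refine mul_lt_mul_of_pos_left (strictAntiOn_exp_mul_cos k ⟨?_, ?_⟩ ⟨?_, ?_⟩ ?_) hc <;> linarith
  · have he := congrArg Prod.fst (spiral_zero k (X, -(X * β)))
    simp only at he
    conv_rhs => rw [← he]
    rw [spiral_fst_eq, spiral_fst_eq]
    refine mul_lt_mul_of_pos_left (strictAntiOn_exp_mul_cos k ⟨?_, ?_⟩ ⟨?_, ?_⟩ ?_) hc <;> linarith

theorem spiral_fullTurn_fst_lt {k X β χ t : ℝ} (hX : 0 < X) (hβ : |k| ≤ β) (hχ : |k| ≤ χ)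
    (h : 1 + χ ^ 2 = (1 + β ^ 2) *
      Real.exp (2 * k * (2 * Real.pi - Real.arctan β - Real.arctan χ)))
    (ht : t ∈ Ioo 0 (2 * Real.pi - Real.arctan β - Real.arctan χ)) :
    (spiral k (X, -(X * β)) t).1 < X := by
  have hk1 : Real.arctan k ≤ Real.arctan β := Real.arctan_mono ((le_abs_self k).trans hβ)
  have hk2 : -Real.arctan χ ≤ Real.arctan k := by
    rw [← Real.arctan_neg]
    exact Real.arctan_mono (by linarith [neg_abs_le k])
  have hc : 0 < X * √(1 + β ^ 2) * Real.exp (-(k * Real.arctan β)) :=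
    mul_pos (mul_pos hX (Real.sqrt_pos.2 (by positivity))) (Real.exp_pos _)
  have hp1 := Real.arctan_lt_pi_div_two β
  have hp2 := Real.neg_pi_div_two_lt_arctan k
  have hp3 := Real.arctan_lt_pi_div_two χ
  have hp4 := Real.arctan_lt_pi_div_two k
  obtain ⟨h1, h2⟩ := ht
  rcases le_total (t + Real.arctan β) (Real.arctan k + Real.pi) with h3 | h3
  · have he := congrArg Prod.fst (spiral_zero k (X, -(X * β)))
    simp only at he
    conv_rhs => rw [← he]
    rw [spiral_fst_eq, spiral_fst_eq]
    refine mul_lt_mul_of_pos_left (strictAntiOn_exp_mul_cos k ⟨?_, ?_⟩ ⟨?_, ?_⟩ ?_) hc <;> linarith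
  · have he := congrArg Prod.fst (spiral_fullTurn (X := X) h)
    simp only at he
    conv_rhs => rw [← he]
    rw [spiral_fst_eq, spiral_fst_eq]
    refine mul_lt_mul_of_pos_left (strictMonoOn_exp_mul_cos k ⟨?_, ?_⟩ ⟨?_, ?_⟩ ?_) hc <;> linarith

theorem lt_spiral_shortTurn_fst {X α t : ℝ} (hX : 0 < X)
    (ht : t ∈ Ioo 0 (2 * Real.arctan α)) : X < (spiral 0 (X, X * α) t).1 := by
  have h := spiral_polar 0 X (-α) t
  rw [show -(X * -α) = X * α by ring, Real.arctan_neg] at h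
  rw [h]
  have hs : 0 < √(1 + α ^ 2) := Real.sqrt_pos.2 (by positivity)
  have hlt : Real.cos (Real.arctan α) < Real.cos (t + -Real.arctan α) := by
    rw [← Real.cos_abs (t + -Real.arctan α)]
    refine Real.cos_lt_cos_of_nonneg_of_le_pi (abs_nonneg _) ?_ ?_
    · linarith [Real.arctan_lt_pi_div_two α, Real.pi_pos]
    · exact abs_lt.2 ⟨by linarith [ht.1], by linarith [ht.2]⟩
  rw [Real.cos_arctan] at hlt
  have hXs : 0 < X * √(1 + α ^ 2) := mul_pos hX hs
  have := mul_lt_mul_of_pos_left hlt hXs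
  simp only [zero_mul, Real.exp_zero, one_mul, neg_sq]
  calc X = X * √(1 + α ^ 2) * (1 / √(1 + α ^ 2)) := by field_simp
    _ < _ := this

/-! ### Gluing arcs into crossing solutions -/

theorem HasDerivWithinAt.translate {σ : ℝ → ℝ × ℝ} {v : ℝ × ℝ} {s s' : Set ℝ} {t c : ℝ}
    (h : HasDerivWithinAt σ v s' (t - c)) (hs : MapsTo (fun u => u - c) s s') :
    HasDerivWithinAt (fun u => σ (u - c)) v s t := by
  have h2 : HasDerivWithinAt (fun u : ℝ => u - c) 1 s t :=
    ((hasDerivAt_id t).sub_const c).hasDerivWithinAt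
  simpa [Function.comp_def] using h.scomp t h2 hs

/-- The defining condition of a crossing solution at a single time. -/
def SolvesAt (X : PWZone → ℝ × ℝ → ℝ × ℝ) (γ : ℝ → ℝ × ℝ) (t : ℝ) : Prop :=
  (∀ z, γ t ∈ PWZone.region z → HasDerivAt γ (X z (γ t)) t) ∧
    ((γ t).1 = -1 → CrossesAt X .L .C γ t) ∧ ((γ t).1 = 1 → CrossesAt X .C .R γ t)

theorem isCrossingSolution_iff {X : PWZone → ℝ × ℝ → ℝ × ℝ} {γ : ℝ → ℝ × ℝ} :
    IsCrossingSolution X γ ↔ ∀ t, SolvesAt X γ t :=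
  ⟨fun h t => ⟨fun z hz => h.inside z t hz, h.left t, h.right t⟩,
    fun h => ⟨fun z t => (h t).1 z, fun t => (h t).2.1, fun t => (h t).2.2⟩⟩

/-- At the point `p` of a switching line, orbits pass from zone `z₁` to the adjacent zone `z₂`. -/
def IsTransitAt (X : PWZone → ℝ × ℝ → ℝ × ℝ) (p : ℝ × ℝ) (z₁ z₂ : PWZone) : Prop :=
  (p.1 = -1 ∧ ((z₁ = .L ∧ z₂ = .C ∧ 0 < (X .L p).1 ∧ 0 < (X .C p).1) ∨
    (z₁ = .C ∧ z₂ = .L ∧ (X .L p).1 < 0 ∧ (X .C p).1 < 0))) ∨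
  (p.1 = 1 ∧ ((z₁ = .C ∧ z₂ = .R ∧ 0 < (X .C p).1 ∧ 0 < (X .R p).1) ∨
    (z₁ = .R ∧ z₂ = .C ∧ (X .C p).1 < 0 ∧ (X .R p).1 < 0)))

theorem IsTransitAt.solvesAt {X : PWZone → ℝ × ℝ → ℝ × ℝ} {p : ℝ × ℝ} {z₁ z₂ : PWZone}
    (h : IsTransitAt X p z₁ z₂) {γ : ℝ → ℝ × ℝ} {t : ℝ} (hp : γ t = p)
    (h1 : HasDerivWithinAt γ (X z₁ p) (Iic t) t) (h2 : HasDerivWithinAt γ (X z₂ p) (Ici t) t) :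
    SolvesAt X γ t := by
  subst hp
  refine ⟨fun z hz => ?_, fun hl => ?_, fun hr => ?_⟩
  · exfalso
    rcases h with ⟨h, -⟩ | ⟨h, -⟩ <;> cases z <;>
      simp only [PWZone.region, mem_ofPred_eq, h] at hz <;> norm_num at hz
  · rcases h with ⟨-, ⟨rfl, rfl, h3, h4⟩ | ⟨rfl, rfl, h3, h4⟩⟩ | ⟨h, -⟩
    · exact .inl ⟨h3, h4, h1, h2⟩
    · exact .inr ⟨h3, h4, h1, h2⟩
    · norm_num [hl] at h
  · rcases h with ⟨h, -⟩ | ⟨-, ⟨rfl, rfl, h3, h4⟩ | ⟨rfl, rfl, h3, h4⟩⟩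
    · norm_num [hr] at h
    · exact .inl ⟨h3, h4, h1, h2⟩
    · exact .inr ⟨h3, h4, h1, h2⟩

theorem SolvesAt.translate {X : PWZone → ℝ × ℝ → ℝ × ℝ} {γ σ : ℝ → ℝ × ℝ} {t c : ℝ}
    (h : SolvesAt X σ (t - c)) (he : γ =ᶠ[𝓝 t] fun u => σ (u - c)) : SolvesAt X γ t := by
  have het : γ t = σ (t - c) := he.eq_of_nhds
  have hd : ∀ (v : ℝ × ℝ) (s s' : Set ℝ), HasDerivWithinAt σ v s' (t - c) →
      MapsTo (fun u => u - c) s s' → HasDerivWithinAt γ v s t := fun v s s' h hs =>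
    (h.translate hs).congr_of_eventuallyEq (he.filter_mono nhdsWithin_le_nhds) het
  have hIc : MapsTo (fun u => u - c) (Iic t) (Iic (t - c)) := fun u hu => by
    simp only [mem_Iic] at *; linarith
  have hCi : MapsTo (fun u => u - c) (Ici t) (Ici (t - c)) := fun u hu => by
    simp only [mem_Ici] at *; linarith
  unfold SolvesAt CrossesAt at *
  rw [het]
  refine ⟨fun z hz => ?_, fun hl => ?_, fun hr => ?_⟩
  · rw [← hasDerivWithinAt_univ]
    exact hd _ _ _ (h.1 z hz).hasDerivWithinAt (mapsTo_univ _ _)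
  · exact (h.2.1 hl).imp (fun ⟨a1, a2, a3, a4⟩ => ⟨a1, a2, hd _ _ _ a3 hIc, hd _ _ _ a4 hCi⟩)
      (fun ⟨a1, a2, a3, a4⟩ => ⟨a1, a2, hd _ _ _ a3 hIc, hd _ _ _ a4 hCi⟩)
  · exact (h.2.2 hr).imp (fun ⟨a1, a2, a3, a4⟩ => ⟨a1, a2, hd _ _ _ a3 hIc, hd _ _ _ a4 hCi⟩)
      (fun ⟨a1, a2, a3, a4⟩ => ⟨a1, a2, hd _ _ _ a3 hIc, hd _ _ _ a4 hCi⟩)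

/-- `γ` restricted to `[0, T]` is a crossing solution from `p`, which it leaves with the field of
`z₁`, to `q`, which it reaches with the field of `z₂`. -/
structure IsCrossingPath (X : PWZone → ℝ × ℝ → ℝ × ℝ) (z₁ z₂ : PWZone) (p q : ℝ × ℝ) (T : ℝ)
    (γ : ℝ → ℝ × ℝ) : Prop where
  pos : 0 < T
  source : γ 0 = p
  target : γ T = q
  start : HasDerivWithinAt γ (X z₁ p) (Ici 0) 0
  finish : HasDerivWithinAt γ (X z₂ q) (Iic T) T
  solves : ∀ t ∈ Ioo 0 T, SolvesAt X γ t

/-- The curve `γ` on `(-∞, T]`, followed by `δ` (with its time shifted by `T`). -/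
noncomputable def concatAt (γ : ℝ → ℝ × ℝ) (T : ℝ) (δ : ℝ → ℝ × ℝ) (t : ℝ) : ℝ × ℝ :=
  if t ≤ T then γ t else δ (t - T)

theorem IsCrossingPath.concat {X : PWZone → ℝ × ℝ → ℝ × ℝ} {z₁ z₂ z₃ z₄ : PWZone}
    {p q r : ℝ × ℝ} {T S : ℝ} {γ δ : ℝ → ℝ × ℝ} (h₁ : IsCrossingPath X z₁ z₂ p q T γ)
    (h₂ : IsCrossingPath X z₃ z₄ q r S δ) (hq : IsTransitAt X q z₂ z₃) :
    IsCrossingPath X z₁ z₄ p r (T + S) (concatAt γ T δ) := by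
  have hT := h₁.pos
  have hS := h₂.pos
  have hle : ∀ t ≤ T, concatAt γ T δ t = γ t := fun t ht => if_pos ht
  have hge : ∀ t, T ≤ t → concatAt γ T δ t = δ (t - T) := fun t ht => by
    rcases ht.eq_or_lt with rfl | ht
    · rw [hle _ le_rfl, sub_self, h₁.target, h₂.source]
    · exact if_neg ht.not_ge
  refine ⟨by linarith, by rw [hle 0 hT.le, h₁.source], ?_, ?_, ?_, fun t ht => ?_⟩
  · rw [hge _ (by linarith), add_sub_cancel_left, h₂.target]
  · refine h₁.start.congr_of_eventuallyEq ?_ (hle 0 hT.le)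
    filter_upwards [mem_nhdsWithin_of_mem_nhds (Iic_mem_nhds hT)] with u hu using hle u hu
  · have : HasDerivWithinAt (fun u => δ (u - T)) (X z₄ r) (Iic (T + S)) (T + S) := by
      refine HasDerivWithinAt.translate (s' := Iic S) ?_ ?_
      · rw [add_sub_cancel_left]; exact h₂.finish
      · intro u hu
        simp only [mem_Iic] at *
        linarith
    refine this.congr_of_eventuallyEq ?_ (hge _ (by linarith))
    filter_upwards [mem_nhdsWithin_of_mem_nhds (Ici_mem_nhds (by linarith : T < T + S))] with u hu
      using hge u hu
  · rcases lt_trichotomy t T with hlt | rfl | hgt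
    · refine SolvesAt.translate (c := 0) (σ := γ) ?_ ?_
      · rw [sub_zero]; exact h₁.solves t ⟨ht.1, hlt⟩
      · filter_upwards [Iic_mem_nhds hlt] with u hu
        rw [hle u hu, sub_zero]
    · refine hq.solvesAt (by rw [hle _ le_rfl, h₁.target]) ?_ ?_
      · exact h₁.finish.congr (fun u hu => hle u hu) (hle _ le_rfl)
      · have : HasDerivWithinAt (fun u => δ (u - t)) (X z₃ q) (Ici t) t := by
          refine HasDerivWithinAt.translate (s' := Ici 0) ?_ ?_
          · rw [sub_self]; exact h₂.start
          · intro u hu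
            simp only [mem_Ici] at *
            linarith
        exact this.congr (fun u hu => hge u hu) (hge _ le_rfl)
    · refine SolvesAt.translate (c := T) (σ := δ)
        (h₂.solves _ ⟨by linarith, by linarith [ht.2]⟩) ?_
      filter_upwards [Ici_mem_nhds hgt] with u hu using hge u hu

theorem IsCrossingPath.concatAt_image {X : PWZone → ℝ × ℝ → ℝ × ℝ} {z₁ z₂ z₃ z₄ : PWZone}
    {p q r : ℝ × ℝ} {T S : ℝ} {γ δ : ℝ → ℝ × ℝ} (h₁ : IsCrossingPath X z₁ z₂ p q T γ)
    (h₂ : IsCrossingPath X z₃ z₄ q r S δ) :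
    concatAt γ T δ '' Icc 0 (T + S) = γ '' Icc 0 T ∪ δ '' Icc 0 S := by
  have hT := h₁.pos
  have hS := h₂.pos
  have hle : ∀ t ≤ T, concatAt γ T δ t = γ t := fun t ht => if_pos ht
  have hge : ∀ t, T ≤ t → concatAt γ T δ t = δ (t - T) := fun t ht => by
    rcases ht.eq_or_lt with rfl | ht
    · rw [hle _ le_rfl, sub_self, h₁.target, h₂.source]
    · exact if_neg ht.not_ge
  ext x
  constructor
  · rintro ⟨t, ht, rfl⟩
    rcases le_total t T with h | h
    · exact .inl ⟨t, ⟨ht.1, h⟩, (hle t h).symm⟩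
    · exact .inr ⟨t - T, ⟨by linarith, by linarith [ht.2]⟩, (hge t h).symm⟩
  · rintro (⟨t, ht, rfl⟩ | ⟨t, ht, rfl⟩)
    · exact ⟨t, ⟨ht.1, by linarith [ht.2]⟩, hle t ht.2⟩
    · exact ⟨t + T, ⟨by linarith [ht.1], by linarith [ht.2]⟩, by
        rw [hge _ (by linarith [ht.1]), add_sub_cancel_right]⟩

/-- The `T`-periodic extension of the restriction of `γ` to `[0, T)`. -/
noncomputable def periodize (γ : ℝ → ℝ × ℝ) (T t : ℝ) : ℝ × ℝ := γ (T * Int.fract (t / T))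

theorem periodize_periodic (γ : ℝ → ℝ × ℝ) {T : ℝ} (hT : 0 < T) :
    Function.Periodic (periodize γ T) T := fun t => by
  simp only [periodize, add_div, div_self hT.ne', Int.fract_add_one]

theorem periodize_eq {γ : ℝ → ℝ × ℝ} {T : ℝ} (hT : 0 < T) (hγ : γ 0 = γ T) (n : ℤ) {t : ℝ}
    (h1 : n * T ≤ t) (h2 : t ≤ n * T + T) : periodize γ T t = γ (t - n * T) := by
  rcases h2.eq_or_lt with h2 | h2
  · have : t / T = (n + 1 : ℤ) := by
      rw [h2]
      push_cast
      field_simp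
    rw [periodize, this, Int.fract_intCast, mul_zero, hγ, h2, add_sub_cancel_left]
  · have : Int.fract (t / T) = t / T - n := by
      rw [Int.fract_eq_iff]
      refine ⟨?_, ?_, n, by ring⟩
      · rw [sub_nonneg, le_div_iff₀ hT]
        exact h1
      · rw [sub_lt_iff_lt_add, div_lt_iff₀ hT]
        linarith
    rw [periodize, this]
    congr 1
    field_simp

theorem range_periodize {γ : ℝ → ℝ × ℝ} {T : ℝ} (hT : 0 < T) (hγ : γ 0 = γ T) :
    range (periodize γ T) = γ '' Icc 0 T := by
  ext x
  constructor
  · rintro ⟨t, rfl⟩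
    refine ⟨_, ⟨mul_nonneg hT.le (Int.fract_nonneg _), ?_⟩, rfl⟩
    exact mul_le_of_le_one_right hT.le (Int.fract_lt_one _).le
  · rintro ⟨t, ht, rfl⟩
    refine ⟨t, ?_⟩
    rw [periodize_eq hT hγ 0 (by simpa using ht.1) (by simpa using ht.2)]
    simp

/-- A crossing path that returns to its starting point, which is a transit point, closes up to a
periodic crossing solution. -/
theorem IsCrossingPath.periodize {X : PWZone → ℝ × ℝ → ℝ × ℝ} {z₁ z₂ : PWZone}
    {p : ℝ × ℝ} {T : ℝ} {γ : ℝ → ℝ × ℝ} (h : IsCrossingPath X z₁ z₂ p p T γ)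
    (hp : IsTransitAt X p z₂ z₁) : IsCrossingSolution X (periodize γ T) := by
  have hT := h.pos
  have hγ : γ 0 = γ T := by rw [h.source, h.target]
  rw [isCrossingSolution_iff]
  intro t
  obtain ⟨n, hn1, hn2⟩ : ∃ n : ℤ, n * T ≤ t ∧ t < n * T + T := by
    refine ⟨⌊t / T⌋, ?_, ?_⟩
    · rw [← le_div_iff₀ hT]
      exact Int.floor_le _
    · have := Int.lt_floor_add_one (t / T)
      rw [div_lt_iff₀ hT] at this
      linarith
  rcases hn1.eq_or_lt with hn1 | hn1
  · have hpt : _root_.periodize γ T t = p := by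
      rw [periodize_eq hT hγ n hn1.le hn2.le, hn1, sub_self, h.source]
    refine hp.solvesAt hpt ?_ ?_
    · have : HasDerivWithinAt (fun u => γ (u - (n - 1 : ℤ) * T)) (X z₂ p) (Iic t) t := by
        refine HasDerivWithinAt.translate (s' := Iic T) ?_ ?_
        · rw [show t - (n - 1 : ℤ) * T = T by push_cast; linarith]
          exact h.finish
        · intro u hu
          simp only [mem_Iic] at *
          push_cast
          linarith
      refine this.congr_of_eventuallyEq_of_mem ?_ self_mem_Iic
      filter_upwards [self_mem_nhdsWithin, mem_nhdsWithin_of_mem_nhds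
        (Ici_mem_nhds (by linarith : t - T < t))] with u hu1 hu2
      simp only [mem_Iic, mem_Ici] at hu1 hu2
      exact periodize_eq hT hγ (n - 1) (by push_cast; linarith) (by push_cast; linarith)
    · have : HasDerivWithinAt (fun u => γ (u - n * T)) (X z₁ p) (Ici t) t := by
        refine HasDerivWithinAt.translate (s' := Ici 0) ?_ ?_
        · rw [hn1, sub_self]
          exact h.start
        · intro u hu
          simp only [mem_Ici] at *
          linarith
      refine this.congr_of_eventuallyEq_of_mem ?_ self_mem_Ici
      filter_upwards [self_mem_nhdsWithin, mem_nhdsWithin_of_mem_nhds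
        (Iic_mem_nhds (by linarith : t < t + T))] with u hu1 hu2
      simp only [mem_Iic, mem_Ici] at hu1 hu2
      exact periodize_eq hT hγ n (by linarith) (by linarith)
  · refine SolvesAt.translate (h.solves (t - n * T) ⟨by linarith, by linarith⟩) ?_
    filter_upwards [Ioo_mem_nhds hn1 hn2] with u hu
    exact periodize_eq hT hγ n hu.1.le hu.2.le

/-- `σ` solves the subsystem of zone `z` and runs in that open zone from `p` to `q`, both
excluded, during the time interval `[0, T]`. -/
structure IsZoneArc (X : PWZone → ℝ × ℝ → ℝ × ℝ) (z : PWZone) (p q : ℝ × ℝ) (T : ℝ)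
    (σ : ℝ → ℝ × ℝ) : Prop where
  pos : 0 < T
  source : σ 0 = p
  target : σ T = q
  deriv : ∀ t, HasDerivAt σ (X z (σ t)) t
  mem : ∀ t ∈ Ioo 0 T, σ t ∈ z.region

theorem PWZone.eq_of_mem_region {z z' : PWZone} {p : ℝ × ℝ} (h : p ∈ z.region)
    (h' : p ∈ z'.region) : z = z' := by
  cases z <;> cases z' <;> simp only [PWZone.region, mem_ofPred_eq] at * <;>
    first | rfl | (exfalso; linarith)

theorem PWZone.isOpen_region (z : PWZone) : IsOpen z.region := by
  cases z
  · exact isOpen_lt continuous_fst continuous_const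
  · exact (isOpen_lt continuous_const continuous_fst).inter
      (isOpen_lt continuous_fst continuous_const)
  · exact isOpen_lt continuous_const continuous_fst

theorem PWZone.fst_ne_of_mem_region {z : PWZone} {p : ℝ × ℝ} (h : p ∈ z.region) :
    p.1 ≠ -1 ∧ p.1 ≠ 1 := by
  cases z <;> simp only [PWZone.region, mem_ofPred_eq] at h
  · exact ⟨h.ne, by linarith⟩
  · exact ⟨h.1.ne', h.2.ne⟩
  · exact ⟨by linarith, h.ne'⟩

theorem IsZoneArc.isCrossingPath {X : PWZone → ℝ × ℝ → ℝ × ℝ} {z : PWZone} {p q : ℝ × ℝ} {T : ℝ}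
    {σ : ℝ → ℝ × ℝ} (h : IsZoneArc X z p q T σ) : IsCrossingPath X z z p q T σ := by
  refine ⟨h.pos, h.source, h.target, ?_, ?_, fun t ht => ?_⟩
  · have := (h.deriv 0).hasDerivWithinAt (s := Ici 0)
    rwa [h.source] at this
  · have := (h.deriv T).hasDerivWithinAt (s := Iic T)
    rwa [h.target] at this
  · have hm := h.mem t ht
    refine ⟨fun z' hz' => ?_, fun h1 => absurd h1 (PWZone.fst_ne_of_mem_region hm).1,
      fun h1 => absurd h1 (PWZone.fst_ne_of_mem_region hm).2⟩
    rw [← PWZone.eq_of_mem_region hm hz']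
    exact h.deriv t

/-- Four arcs that close up through transit points form a crossing periodic orbit. -/
theorem exists_periodic_of_zoneArcs {X : PWZone → ℝ × ℝ → ℝ × ℝ} {z₁ z₂ z₃ z₄ : PWZone}
    {p₁ p₂ p₃ p₄ : ℝ × ℝ} {T₁ T₂ T₃ T₄ : ℝ} {σ₁ σ₂ σ₃ σ₄ : ℝ → ℝ × ℝ}
    (h₁ : IsZoneArc X z₁ p₁ p₂ T₁ σ₁) (h₂ : IsZoneArc X z₂ p₂ p₃ T₂ σ₂)
    (h₃ : IsZoneArc X z₃ p₃ p₄ T₃ σ₃) (h₄ : IsZoneArc X z₄ p₄ p₁ T₄ σ₄)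
    (t₁ : IsTransitAt X p₁ z₄ z₁) (t₂ : IsTransitAt X p₂ z₁ z₂) (t₃ : IsTransitAt X p₃ z₂ z₃)
    (t₄ : IsTransitAt X p₄ z₃ z₄) :
    ∃ (γ : ℝ → ℝ × ℝ) (T : ℝ), IsCrossingSolution X γ ∧ 0 < T ∧ Function.Periodic γ T ∧
      γ 0 = p₁ ∧ range γ =
        σ₁ '' Icc 0 T₁ ∪ σ₂ '' Icc 0 T₂ ∪ σ₃ '' Icc 0 T₃ ∪ σ₄ '' Icc 0 T₄ := by
  have k₂ := h₁.isCrossingPath.concat h₂.isCrossingPath t₂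
  have k₃ := k₂.concat h₃.isCrossingPath t₃
  have k₄ := k₃.concat h₄.isCrossingPath t₄
  have he := k₄.source.trans k₄.target.symm
  refine ⟨_, _, k₄.periodize t₁, k₄.pos, periodize_periodic _ k₄.pos, ?_, ?_⟩
  · rw [periodize_eq k₄.pos he 0 (by simp) (by simpa using k₄.pos.le)]
    simpa using k₄.source
  · rw [range_periodize k₄.pos he, k₃.concatAt_image h₄.isCrossingPath,
      k₂.concatAt_image h₃.isCrossingPath, h₁.isCrossingPath.concatAt_image h₂.isCrossingPath]

/-! ### The perturbed system and its loops -/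

/-- The three subsystems for the perturbation used below: foci with expansion rates `k` around
`(-5, 2)` in the left zone and `m` around the origin in the central zone, and a rotation around
`(0, -s)` in the right zone. -/
def focusField (k m s : ℝ) : PWZone → ℝ × ℝ → ℝ × ℝ
  | .L => fun p => (p.1 + 2 * p.2 + 1 + k * (p.1 + 5), -p.1 - p.2 - 3 + k * (p.2 - 2))
  | .C => fun p => (p.2 + m * p.1, -p.1 + m * p.2)
  | .R => fun p => (p.2 + s, -p.1)

/-- The orbit of the right subsystem that starts at `(1, a)`. -/
noncomputable def arcR (s a t : ℝ) : ℝ × ℝ :=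
  ((spiral 0 (1, 1 * (a + s)) t).1, (spiral 0 (1, 1 * (a + s)) t).2 - s)

/-- The inverse of the coordinate change `(x, y) ↦ (x + 5, x + 2 y + 1)`, which turns the left
subsystem into a standard focus. -/
noncomputable def leftChart (p : ℝ × ℝ) : ℝ × ℝ := (p.1 - 5, 2 + (p.2 - p.1) / 2)

/-- The orbit of the left subsystem that starts at `(-1, -2 c)`. -/
noncomputable def arcL (k c t : ℝ) : ℝ × ℝ := leftChart (spiral k (4, -(4 * c)) t)

/-- An orbit of a focus with expansion rate `k` that starts at slope `y` below the horizontal axis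
and turns by the angle `θ - arctan y - arctan y'` ends at slope `y'`. The orbits run between
vertical lines at equal distances from the focus, so that the slopes determine the radii. -/
def IsTurn (θ k y y' : ℝ) : Prop :=
  1 + y' ^ 2 = (1 + y ^ 2) * Real.exp (2 * k * (θ - Real.arctan y - Real.arctan y'))

theorem hasDerivAt_spiral (k m : ℝ) (s : ℝ) (p : ℝ × ℝ) (t : ℝ) :
    HasDerivAt (spiral m p) (focusField k m s .C (spiral m p t)) t :=
  (hasDerivAt_spiral_fst m p t).prodMk (hasDerivAt_spiral_snd m p t)

theorem hasDerivAt_leftChart_spiral (k m s : ℝ) (p : ℝ × ℝ) (t : ℝ) :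
    HasDerivAt (fun t => leftChart (spiral k p t))
      (focusField k m s .L (leftChart (spiral k p t))) t := by
  have h1 := hasDerivAt_spiral_fst k p t
  have h2 := hasDerivAt_spiral_snd k p t
  refine ((h1.sub_const 5).prodMk (((h2.sub h1).div_const 2).const_add 2)).congr_deriv ?_
  ext <;> simp only [focusField, leftChart] <;> ring

theorem hasDerivAt_rightChart_spiral (k m s : ℝ) (p : ℝ × ℝ) (t : ℝ) :
    HasDerivAt (fun t => ((spiral 0 p t).1, (spiral 0 p t).2 - s))
      (focusField k m s .R ((spiral 0 p t).1, (spiral 0 p t).2 - s)) t := by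
  refine ((hasDerivAt_spiral_fst 0 p t).prodMk
    ((hasDerivAt_spiral_snd 0 p t).sub_const s)).congr_deriv ?_
  ext <;> simp [focusField]

theorem spiral_neg (k : ℝ) (p : ℝ × ℝ) (t : ℝ) : spiral k (-p) t = -spiral k p t := by
  ext <;> simp [spiral] <;> ring

theorem arctan_add_arctan_lt_pi (x y : ℝ) : Real.arctan x + Real.arctan y < Real.pi := by
  linarith [Real.arctan_lt_pi_div_two x, Real.arctan_lt_pi_div_two y]

theorem isZoneArc_arcR (k m : ℝ) {s a : ℝ} (h : 0 < a + s) :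
    IsZoneArc (focusField k m s) .R (1, a) (1, -(a + 2 * s)) (2 * Real.arctan (a + s))
      (arcR s a) where
  pos := by linarith [Real.arctan_pos.2 h]
  source := by simp [arcR, spiral_zero]
  target := by
    rw [arcR, spiral_shortTurn]
    ext
    · rfl
    · simp only; ring
  deriv t := hasDerivAt_rightChart_spiral k m s _ t
  mem t ht := lt_spiral_shortTurn_fst one_pos ht

theorem isZoneArc_lower (k s : ℝ) {m b c : ℝ} (hb : |m| < b) (hc : |m| < c)
    (h : IsTurn Real.pi m b c) :
    IsZoneArc (focusField k m s) .C (1, -b) (-1, -c)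
      (Real.pi - Real.arctan b - Real.arctan c) (spiral m (1, -b)) where
  pos := by linarith [arctan_add_arctan_lt_pi b c]
  source := spiral_zero _ _
  target := by simpa using spiral_halfTurn (X := 1) h
  deriv t := hasDerivAt_spiral k m s _ t
  mem t ht := by simpa [PWZone.region] using spiral_halfTurn_fst_mem one_pos hb.le hc.le h ht

theorem isZoneArc_upper (k s : ℝ) {m d a : ℝ} (hd : |m| < d) (ha : |m| < a)
    (h : IsTurn Real.pi m d a) :
    IsZoneArc (focusField k m s) .C (-1, d) (1, a)
      (Real.pi - Real.arctan d - Real.arctan a) (spiral m (-1, d)) where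
  pos := by linarith [arctan_add_arctan_lt_pi d a]
  source := spiral_zero _ _
  target := by
    have h1 := (isZoneArc_lower k s hd ha h).target
    have h2 := spiral_neg m (1, -d) (Real.pi - Real.arctan d - Real.arctan a)
    rw [h1] at h2
    simpa using h2
  deriv t := hasDerivAt_spiral k m s _ t
  mem t ht := by
    have h1 := (isZoneArc_lower k s hd ha h).mem t ht
    have h2 := spiral_neg m (1, -d) t
    simp only [Prod.neg_mk, neg_neg] at h2
    simp only [PWZone.region, mem_ofPred_eq, h2, Prod.fst_neg] at h1 ⊢
    exact ⟨by linarith, by linarith⟩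

theorem isZoneArc_arcL (m s : ℝ) {k c d : ℝ} (hc : |k| < c) (hd : |k| < d)
    (h : IsTurn (2 * Real.pi) k c d) :
    IsZoneArc (focusField k m s) .L (-1, -(2 * c)) (-1, 2 * d)
      (2 * Real.pi - Real.arctan c - Real.arctan d) (arcL k c) where
  pos := by linarith [arctan_add_arctan_lt_pi c d, Real.pi_pos]
  source := by
    ext
    · simp only [arcL, leftChart, spiral_zero]; norm_num
    · simp only [arcL, leftChart, spiral_zero]; ring
  target := by
    rw [arcL, spiral_fullTurn h, leftChart]
    ext
    · norm_num
    · simp only; ring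
  deriv t := hasDerivAt_leftChart_spiral k m s _ t
  mem t ht := by
    have := spiral_fullTurn_fst_lt (X := 4) (by norm_num) hc.le hd.le h ht
    simp only [PWZone.region, mem_ofPred_eq, arcL, leftChart]
    linarith

/-- The data of a loop that crosses the switching lines at `(1, a)`, `(1, -(a + 2 s))`,
`(-1, -2 c)` and `(-1, 2 d)`: the closing conditions for the arcs, and the inequalities that make
the four points crossing points. -/
structure IsLoop (k m s a c d : ℝ) : Prop where
  pos_right : 0 < a + s
  lt_a : |m| < a
  lt_b : |m| < a + 2 * s
  lt_c : |m| < 2 * c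
  lt_d : |m| < 2 * d
  lt_left_c : |k| < c
  lt_left_d : |k| < d
  lower : IsTurn Real.pi m (a + 2 * s) (2 * c)
  left : IsTurn (2 * Real.pi) k c d
  upper : IsTurn Real.pi m (2 * d) a

/-- The closed curve formed by the four arcs of a loop. -/
noncomputable def loopSet (k m s a c d : ℝ) : Set (ℝ × ℝ) :=
  arcR s a '' Icc 0 (2 * Real.arctan (a + s)) ∪
  spiral m (1, -(a + 2 * s)) ''
    Icc 0 (Real.pi - Real.arctan (a + 2 * s) - Real.arctan (2 * c)) ∪
  arcL k c '' Icc 0 (2 * Real.pi - Real.arctan c - Real.arctan d) ∪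
  spiral m (-1, 2 * d) '' Icc 0 (Real.pi - Real.arctan (2 * d) - Real.arctan a)

theorem isTransitAt_CR (k : ℝ) {m s a : ℝ} (h : 0 < a + s) (ha : |m| < a) :
    IsTransitAt (focusField k m s) (1, a) .C .R := by
  refine .inr ⟨rfl, .inl ⟨rfl, rfl, ?_, ?_⟩⟩ <;> simp only [focusField]
  · linarith [neg_abs_le m]
  · exact h

theorem isTransitAt_RC (k : ℝ) {m s b : ℝ} (h : s < b) (hb : |m| < b) :
    IsTransitAt (focusField k m s) (1, -b) .R .C := by
  refine .inr ⟨rfl, .inr ⟨rfl, rfl, ?_, ?_⟩⟩ <;> simp only [focusField]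
  · linarith [le_abs_self m]
  · linarith

theorem isTransitAt_CL (s : ℝ) {k m c : ℝ} (hk : |k| < c) (hm : |m| < 2 * c) :
    IsTransitAt (focusField k m s) (-1, -(2 * c)) .C .L := by
  refine .inl ⟨rfl, .inr ⟨rfl, rfl, ?_, ?_⟩⟩ <;> simp only [focusField]
  · linarith [le_abs_self k]
  · linarith [neg_abs_le m]

theorem isTransitAt_LC (s : ℝ) {k m d : ℝ} (hk : |k| < d) (hm : |m| < 2 * d) :
    IsTransitAt (focusField k m s) (-1, 2 * d) .L .C := by
  refine .inl ⟨rfl, .inl ⟨rfl, rfl, ?_, ?_⟩⟩ <;> simp only [focusField]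
  · linarith [neg_abs_le k]
  · linarith [le_abs_self m]

theorem IsLoop.exists_periodic {k m s a c d : ℝ} (h : IsLoop k m s a c d) :
    ∃ (γ : ℝ → ℝ × ℝ) (T : ℝ), IsCrossingSolution (focusField k m s) γ ∧ 0 < T ∧
      Function.Periodic γ T ∧ γ 0 = (1, a) ∧ range γ = loopSet k m s a c d :=
  exists_periodic_of_zoneArcs (isZoneArc_arcR k m h.pos_right)
    (isZoneArc_lower k s h.lt_b h.lt_c h.lower) (isZoneArc_arcL m s h.lt_left_c h.lt_left_d h.left)
    (isZoneArc_upper k s h.lt_d h.lt_a h.upper) (isTransitAt_CR k h.pos_right h.lt_a)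
    (isTransitAt_RC k (by linarith [h.pos_right]) h.lt_b) (isTransitAt_CL s h.lt_left_c h.lt_c)
    (isTransitAt_LC s h.lt_left_d h.lt_d)

theorem IsZoneArc.inter_region_nonempty {X : PWZone → ℝ × ℝ → ℝ × ℝ} {z : PWZone} {p q : ℝ × ℝ}
    {T : ℝ} {σ : ℝ → ℝ × ℝ} (h : IsZoneArc X z p q T σ) :
    (σ '' Icc 0 T ∩ z.region).Nonempty :=
  have hT := h.pos
  ⟨σ (T / 2), ⟨T / 2, ⟨by linarith, by linarith⟩, rfl⟩, h.mem _ ⟨by linarith, by linarith⟩⟩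

theorem IsLoop.visitsAllZones {k m s a c d : ℝ} (h : IsLoop k m s a c d) :
    VisitsAllZones (loopSet k m s a c d) := by
  have h1 := (isZoneArc_arcR k m h.pos_right).inter_region_nonempty
  have h2 := (isZoneArc_lower k s h.lt_b h.lt_c h.lower).inter_region_nonempty
  have h3 := (isZoneArc_arcL m s h.lt_left_c h.lt_left_d h.left).inter_region_nonempty
  rintro (_ | _ | _)
  · exact h3.mono (inter_subset_inter_left _ fun x hx => .inl (.inr hx))
  · exact h2.mono (inter_subset_inter_left _ fun x hx => .inl (.inl (.inr hx)))
  · exact h1.mono (inter_subset_inter_left _ fun x hx => .inl (.inl (.inl hx)))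

theorem IsLoop.isCrossingPeriodicOrbit {k m s a c d : ℝ} (h : IsLoop k m s a c d) :
    IsCrossingPeriodicOrbit (focusField k m s) (loopSet k m s a c d) := by
  obtain ⟨γ, T, hγ, hT, hp, h0, hr⟩ := h.exists_periodic
  refine ⟨γ, T, hγ, hT, hp, ?_, hr⟩
  -- the orbit visits the left zone, whereas `γ 0` lies on the line `x = 1`
  obtain ⟨p, hp, hpL⟩ := h.visitsAllZones .L
  rw [← hr] at hp
  obtain ⟨t, rfl⟩ := hp
  refine ⟨t, fun he => ?_⟩
  rw [he, h0] at hpL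
  simp only [PWZone.region, mem_ofPred_eq] at hpL
  norm_num at hpL

theorem IsZoneArc.eq_or_eq_of_not_mem_region {X : PWZone → ℝ × ℝ → ℝ × ℝ} {z : PWZone}
    {p q x : ℝ × ℝ} {T : ℝ} {σ : ℝ → ℝ × ℝ} (h : IsZoneArc X z p q T σ)
    (hx : x ∈ σ '' Icc 0 T) (hn : x ∉ z.region) : x = p ∨ x = q := by
  obtain ⟨t, ht, rfl⟩ := hx
  rcases ht.1.eq_or_lt with h0 | h0
  · exact .inl (h0 ▸ h.source)
  rcases ht.2.eq_or_lt with h1 | h1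
  · exact .inr (h1 ▸ h.target)
  exact absurd (h.mem t ⟨h0, h1⟩) hn

/-- A loop meets the switching lines only at its four corners. -/
theorem IsLoop.eq_corner {k m s a c d : ℝ} (h : IsLoop k m s a c d) {x : ℝ × ℝ}
    (hx : x ∈ loopSet k m s a c d) (hn : ∀ z, x ∉ PWZone.region z) :
    x = (1, a) ∨ x = (1, -(a + 2 * s)) ∨ x = (-1, -(2 * c)) ∨ x = (-1, 2 * d) := by
  rcases hx with ((hx | hx) | hx) | hx
  · have := (isZoneArc_arcR k m h.pos_right).eq_or_eq_of_not_mem_region hx (hn _)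
    tauto
  · have := (isZoneArc_lower k s h.lt_b h.lt_c h.lower).eq_or_eq_of_not_mem_region hx (hn _)
    tauto
  · have := (isZoneArc_arcL m s h.lt_left_c h.lt_left_d h.left).eq_or_eq_of_not_mem_region hx (hn _)
    tauto
  · have := (isZoneArc_upper k s h.lt_d h.lt_a h.upper).eq_or_eq_of_not_mem_region hx (hn _)
    tauto

/-! ### Uniqueness of crossing solutions -/


/-- From the time `t` on, `γ` solves for a while the subsystem of zone `z`. -/
def FollowsAt (X : PWZone → ℝ × ℝ → ℝ × ℝ) (z : PWZone) (γ : ℝ → ℝ × ℝ) (t : ℝ) : Prop :=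
  ∀ᶠ u in 𝓝[≥] t, HasDerivWithinAt γ (X z (γ u)) (Ici u) u

/-- Solutions through `p` continue in zone `z`. -/
def IsEntryPoint (X : PWZone → ℝ × ℝ → ℝ × ℝ) (z : PWZone) (p : ℝ × ℝ) : Prop :=
  p ∈ z.region ∨ ∃ z', IsTransitAt X p z' z

theorem PWZone.exists_mem_region_or (p : ℝ × ℝ) :
    (∃ z, p ∈ PWZone.region z) ∨ p.1 = -1 ∨ p.1 = 1 := by
  rcases lt_trichotomy p.1 (-1) with h | h | h
  · exact .inl ⟨.L, h⟩
  · exact .inr (.inl h)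
  · rcases lt_trichotomy p.1 1 with h' | h' | h'
    · exact .inl ⟨.C, h, h'⟩
    · exact .inr (.inr h')
    · exact .inl ⟨.R, h'⟩

theorem CrossesAt.continuousAt {X : PWZone → ℝ × ℝ → ℝ × ℝ} {A B : PWZone} {γ : ℝ → ℝ × ℝ} {t : ℝ}
    (h : CrossesAt X A B γ t) : ContinuousAt γ t := by
  rw [continuousAt_iff_continuous_left_right]
  rcases h with ⟨-, -, h1, h2⟩ | ⟨-, -, h1, h2⟩ <;>
    exact ⟨h1.continuousWithinAt, h2.continuousWithinAt⟩

theorem IsCrossingSolution.continuous {X : PWZone → ℝ × ℝ → ℝ × ℝ} {γ : ℝ → ℝ × ℝ}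
    (h : IsCrossingSolution X γ) : Continuous γ := by
  rw [continuous_iff_continuousAt]
  intro t
  rcases PWZone.exists_mem_region_or (γ t) with ⟨z, hz⟩ | hl | hr
  · exact (h.inside z t hz).continuousAt
  · exact (h.left t hl).continuousAt
  · exact (h.right t hr).continuousAt

theorem HasDerivWithinAt.eventually_lt_of_pos {f : ℝ → ℝ} {v t : ℝ}
    (h : HasDerivWithinAt f v (Ici t) t) (hv : 0 < v) : ∀ᶠ u in 𝓝[>] t, f t < f u := by
  have h1 := hasDerivWithinAt_iff_tendsto_slope' (s := Ioi t) (by simp) |>.1 h.Ioi_of_Ici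
  filter_upwards [h1.eventually (lt_mem_nhds hv), self_mem_nhdsWithin] with u hu hu'
  exact (slope_pos_iff_of_le (le_of_lt hu')).1 hu

theorem HasDerivWithinAt.eventually_lt_of_neg {f : ℝ → ℝ} {v t : ℝ}
    (h : HasDerivWithinAt f v (Ici t) t) (hv : v < 0) : ∀ᶠ u in 𝓝[>] t, f u < f t := by
  filter_upwards [h.neg.eventually_lt_of_pos (neg_pos.2 hv)] with u hu
  simpa using hu

theorem HasDerivWithinAt.fst {E F : Type*} [NormedAddCommGroup E] [NormedSpace ℝ E]
    [NormedAddCommGroup F] [NormedSpace ℝ F] {γ : ℝ → E × F} {v : E × F} {s : Set ℝ} {t : ℝ}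
    (h : HasDerivWithinAt γ v s t) : HasDerivWithinAt (fun u => (γ u).1) v.1 s t :=
  HasFDerivAt.comp_hasDerivWithinAt t (hasFDerivAt_fst (𝕜 := ℝ) (p := γ t)) h

theorem HasDerivAt.fst {E F : Type*} [NormedAddCommGroup E] [NormedSpace ℝ E]
    [NormedAddCommGroup F] [NormedSpace ℝ F] {γ : ℝ → E × F} {v : E × F} {t : ℝ}
    (h : HasDerivAt γ v t) : HasDerivAt (fun u => (γ u).1) v.1 t :=
  HasFDerivAt.comp_hasDerivAt t (hasFDerivAt_fst (𝕜 := ℝ) (p := γ t)) h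

theorem HasDerivWithinAt.snd {E F : Type*} [NormedAddCommGroup E] [NormedSpace ℝ E]
    [NormedAddCommGroup F] [NormedSpace ℝ F] {γ : ℝ → E × F} {v : E × F} {s : Set ℝ} {t : ℝ}
    (h : HasDerivWithinAt γ v s t) : HasDerivWithinAt (fun u => (γ u).2) v.2 s t :=
  HasFDerivAt.comp_hasDerivWithinAt t (hasFDerivAt_snd (𝕜 := ℝ) (p := γ t)) h

theorem HasDerivAt.snd {E F : Type*} [NormedAddCommGroup E] [NormedSpace ℝ E]
    [NormedAddCommGroup F] [NormedSpace ℝ F] {γ : ℝ → E × F} {v : E × F} {t : ℝ}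
    (h : HasDerivAt γ v t) : HasDerivAt (fun u => (γ u).2) v.2 t :=
  HasFDerivAt.comp_hasDerivAt t (hasFDerivAt_snd (𝕜 := ℝ) (p := γ t)) h

theorem IsCrossingSolution.exists_isEntryPoint {X : PWZone → ℝ × ℝ → ℝ × ℝ} {γ : ℝ → ℝ × ℝ}
    (h : IsCrossingSolution X γ) (t : ℝ) : ∃ z, IsEntryPoint X z (γ t) := by
  rcases PWZone.exists_mem_region_or (γ t) with ⟨z, hz⟩ | hl | hr
  · exact ⟨z, .inl hz⟩
  · rcases h.left t hl with ⟨h1, h2, -, -⟩ | ⟨h1, h2, -, -⟩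
    · exact ⟨.C, .inr ⟨.L, .inl ⟨hl, .inl ⟨rfl, rfl, h1, h2⟩⟩⟩⟩
    · exact ⟨.L, .inr ⟨.C, .inl ⟨hl, .inr ⟨rfl, rfl, h1, h2⟩⟩⟩⟩
  · rcases h.right t hr with ⟨h1, h2, -, -⟩ | ⟨h1, h2, -, -⟩
    · exact ⟨.R, .inr ⟨.C, .inr ⟨hr, .inl ⟨rfl, rfl, h1, h2⟩⟩⟩⟩
    · exact ⟨.C, .inr ⟨.R, .inr ⟨hr, .inr ⟨rfl, rfl, h1, h2⟩⟩⟩⟩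

theorem IsCrossingSolution.hasDerivWithinAt_of_isTransitAt {X : PWZone → ℝ × ℝ → ℝ × ℝ}
    {γ : ℝ → ℝ × ℝ} (h : IsCrossingSolution X γ) {t : ℝ} {z z' : PWZone}
    (ht : IsTransitAt X (γ t) z' z) : HasDerivWithinAt γ (X z (γ t)) (Ici t) t := by
  rcases ht with ⟨hl, ht⟩ | ⟨hr, ht⟩
  · rcases h.left t hl with ⟨h1, h2, -, h3⟩ | ⟨h1, h2, -, h3⟩ <;>
      rcases ht with ⟨rfl, rfl, h4, h5⟩ | ⟨rfl, rfl, h4, h5⟩ <;>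
      first | exact h3 | (exfalso; linarith)
  · rcases h.right t hr with ⟨h1, h2, -, h3⟩ | ⟨h1, h2, -, h3⟩ <;>
      rcases ht with ⟨rfl, rfl, h4, h5⟩ | ⟨rfl, rfl, h4, h5⟩ <;>
      first | exact h3 | (exfalso; linarith)

theorem IsCrossingSolution.eventually_mem_region {X : PWZone → ℝ × ℝ → ℝ × ℝ}
    {γ : ℝ → ℝ × ℝ} (h : IsCrossingSolution X γ) {t : ℝ} {z : PWZone}
    (ht : IsEntryPoint X z (γ t)) : ∀ᶠ u in 𝓝[>] t, γ u ∈ z.region := by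
  have hc : ContinuousAt (fun u => (γ u).1) t := h.continuous.fst.continuousAt
  rcases ht with hz | ⟨z', ht⟩
  · exact (h.continuous.continuousAt.eventually
      (z.isOpen_region.mem_nhds hz)).filter_mono nhdsWithin_le_nhds
  · have hd := (h.hasDerivWithinAt_of_isTransitAt ht).fst
    have hlt : (γ t).1 < 1 → ∀ᶠ u in 𝓝[>] t, (γ u).1 < 1 := fun h1 =>
      (hc.eventually (gt_mem_nhds h1)).filter_mono nhdsWithin_le_nhds
    have hgt : -1 < (γ t).1 → ∀ᶠ u in 𝓝[>] t, -1 < (γ u).1 := fun h1 =>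
      (hc.eventually (lt_mem_nhds h1)).filter_mono nhdsWithin_le_nhds
    rcases ht with ⟨hl, ⟨rfl, rfl, h1, h2⟩ | ⟨rfl, rfl, h1, h2⟩⟩ |
      ⟨hr, ⟨rfl, rfl, h1, h2⟩ | ⟨rfl, rfl, h1, h2⟩⟩
    · filter_upwards [hd.eventually_lt_of_pos h2, hlt (by linarith)] with u h3 h4
      exact ⟨hl ▸ h3, h4⟩
    · filter_upwards [hd.eventually_lt_of_neg h1] with u h3
      exact h3.trans_eq hl
    · filter_upwards [hd.eventually_lt_of_pos h2] with u h3
      exact hr.symm.trans_lt h3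
    · filter_upwards [hd.eventually_lt_of_neg h1, hgt (by linarith)] with u h3 h4
      exact ⟨h4, hr ▸ h3⟩

theorem IsCrossingSolution.followsAt {X : PWZone → ℝ × ℝ → ℝ × ℝ} {γ : ℝ → ℝ × ℝ}
    (h : IsCrossingSolution X γ) {t : ℝ} {z : PWZone} (ht : IsEntryPoint X z (γ t)) :
    FollowsAt X z γ t := by
  have h0 : HasDerivWithinAt γ (X z (γ t)) (Ici t) t := by
    rcases ht with hz | ⟨z', ht⟩
    · exact (h.inside z t hz).hasDerivWithinAt
    · exact h.hasDerivWithinAt_of_isTransitAt ht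
  rw [FollowsAt, ← Ioi_insert, nhdsWithin_insert, eventually_sup]
  refine ⟨h0, ?_⟩
  filter_upwards [h.eventually_mem_region ht] with u hu using (h.inside z u hu).hasDerivWithinAt

theorem FollowsAt.translate {X : PWZone → ℝ × ℝ → ℝ × ℝ} {z : PWZone} {γ : ℝ → ℝ × ℝ}
    {t₀ s : ℝ} (h : FollowsAt X z γ (t₀ + s)) : FollowsAt X z (fun u => γ (t₀ + u)) s := by
  have h1 : Tendsto (fun u => t₀ + u) (𝓝[≥] s) (𝓝[≥] (t₀ + s)) := by
    refine tendsto_nhdsWithin_iff.2 ⟨?_, ?_⟩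
    · exact ((continuous_const.add continuous_id).tendsto s).mono_left nhdsWithin_le_nhds
    · filter_upwards [self_mem_nhdsWithin] with u hu
      simp only [mem_Ici] at *
      linarith
  filter_upwards [h1.eventually h] with u hu
  have he : (fun u => γ (t₀ + u)) = fun u => γ (u - -t₀) := by
    ext1 u
    rw [sub_neg_eq_add, add_comm]
  rw [he]
  refine HasDerivWithinAt.translate (s' := Ici (t₀ + u)) ?_ fun v hv => ?_
  · rwa [sub_neg_eq_add, add_comm u]
  · simp only [mem_Ici] at *
    linarith

/-- Two curves that keep following the same subsystem wherever they agree, agree. -/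
theorem eqOn_of_followsAt {X : PWZone → ℝ × ℝ → ℝ × ℝ} (hX : ∀ z, ∃ K, LipschitzWith K (X z))
    {f g : ℝ → ℝ × ℝ} {T : ℝ} (hf : Continuous f) (hg : Continuous g) (h0 : f 0 = g 0)
    (h : ∀ s ∈ Ico 0 T, f s = g s → ∃ z, FollowsAt X z f s ∧ FollowsAt X z g s) :
    ∀ s ∈ Icc 0 T, f s = g s := by
  refine IsClosed.Icc_subset_of_forall_mem_nhdsWithin (s := {s | f s = g s})
    ((isClosed_eq hf hg).inter isClosed_Icc) h0 fun s hs => ?_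
  obtain ⟨z, hfz, hgz⟩ := h s hs.2 hs.1
  obtain ⟨K, hK⟩ := hX z
  obtain ⟨u, hu, hu'⟩ := mem_nhdsGE_iff_exists_Ico_subset.1 (hfz.and hgz)
  have hu0 : s < u := hu
  refine mem_of_superset (Ioo_mem_nhdsGT hu0) fun v hv => ?_
  exact ODE_solution_unique_of_mem_Icc_right (v := fun _ => X z) (s := fun _ => univ) (K := K)
    (a := s) (b := u) (fun _ _ => hK.lipschitzOnWith) hf.continuousOn
    (fun w hw => (hu' hw).1) (fun _ _ => mem_univ _) hg.continuousOn
    (fun w hw => (hu' hw).2) (fun _ _ => mem_univ _) hs.1 ⟨hv.1.le, hv.2.le⟩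

/-- A crossing solution that enters a zone at the source of an arc runs through the arc. -/
theorem IsZoneArc.eq_of_isTransitAt {X : PWZone → ℝ × ℝ → ℝ × ℝ}
    (hX : ∀ z, ∃ K, LipschitzWith K (X z)) {z z' : PWZone} {p q : ℝ × ℝ} {T : ℝ} {σ : ℝ → ℝ × ℝ}
    (h : IsZoneArc X z p q T σ) (hp : IsTransitAt X p z' z) {γ : ℝ → ℝ × ℝ}
    (hγ : IsCrossingSolution X γ) {t : ℝ} (ht : γ t = p) : γ (t + T) = q := by
  have hc : Continuous σ := continuous_iff_continuousAt.2 fun t => (h.deriv t).continuousAt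
  rw [← h.target]
  refine eqOn_of_followsAt hX (f := fun s => γ (t + s)) (T := T)
    (hγ.continuous.comp (continuous_const.add continuous_id)) hc (by simp [ht, h.source])
    (fun s hs he => ⟨z, ?_, .of_forall fun u => (h.deriv u).hasDerivWithinAt⟩)
    T ⟨h.pos.le, le_rfl⟩
  refine (hγ.followsAt ?_).translate
  rcases hs.1.eq_or_lt with rfl | hs0
  · rw [add_zero, ht]
    exact .inr ⟨z', hp⟩
  · rw [he]
    exact .inl (h.mem s ⟨hs0, hs.2⟩)

/-- Forward uniqueness of crossing solutions. -/
theorem IsCrossingSolution.eq_of_eq {X : PWZone → ℝ × ℝ → ℝ × ℝ}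
    (hX : ∀ z, ∃ K, LipschitzWith K (X z)) {γ δ : ℝ → ℝ × ℝ} (hγ : IsCrossingSolution X γ)
    (hδ : IsCrossingSolution X δ) {t u : ℝ} (h : γ t = δ u) {s : ℝ} (hs : 0 ≤ s) :
    γ (t + s) = δ (u + s) := by
  refine eqOn_of_followsAt hX (f := fun s => γ (t + s)) (g := fun s => δ (u + s)) (T := s)
    (hγ.continuous.comp (continuous_const.add continuous_id))
    (hδ.continuous.comp (continuous_const.add continuous_id)) (by simpa using h)
    (fun v hv he => ?_) s ⟨hs, le_rfl⟩
  obtain ⟨z, hz⟩ := hγ.exists_isEntryPoint (t + v)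
  refine ⟨z, (hγ.followsAt hz).translate, (hδ.followsAt ?_).translate⟩
  rwa [← he]

theorem Function.Periodic.image_Ici_eq_range {α : Type*} {γ : ℝ → α} {T : ℝ}
    (h : Function.Periodic γ T) (hT : 0 < T) (t : ℝ) : γ '' Ici t = range γ := by
  refine subset_antisymm (image_subset_range _ _) ?_
  rintro _ ⟨u, rfl⟩
  obtain ⟨v, hv, he⟩ := h.exists_mem_Ico hT u t
  exact ⟨v, hv.1, he.symm⟩

/-- Periodic crossing solutions with a common point have the same orbit. -/
theorem IsCrossingSolution.range_eq_of_eq {X : PWZone → ℝ × ℝ → ℝ × ℝ}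
    (hX : ∀ z, ∃ K, LipschitzWith K (X z)) {γ δ : ℝ → ℝ × ℝ} (hγ : IsCrossingSolution X γ)
    (hδ : IsCrossingSolution X δ) {T S : ℝ} (hT : 0 < T) (hS : 0 < S)
    (hγT : Function.Periodic γ T) (hδS : Function.Periodic δ S) {t u : ℝ} (h : γ t = δ u) :
    range γ = range δ := by
  have key : ∀ s, 0 ≤ s → γ (t + s) = δ (u + s) := fun s hs => hγ.eq_of_eq hX hδ h hs
  rw [← hγT.image_Ici_eq_range hT t, ← hδS.image_Ici_eq_range hS u]
  apply subset_antisymm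
  · rintro _ ⟨v, hv, rfl⟩
    refine ⟨u + (v - t), by simpa using hv, ?_⟩
    rw [← key _ (by simpa using hv)]
    congr 1
    ring
  · rintro _ ⟨v, hv, rfl⟩
    refine ⟨t + (v - u), by simpa using hv, ?_⟩
    rw [key _ (by simpa using hv)]
    congr 1
    ring

/-! ### Isolation of loops -/

theorem exists_lipschitzWith_focusField (k m s : ℝ) (z : PWZone) :
    ∃ K, LipschitzWith K (focusField k m s z) := by
  have hlin : IsLinearMap ℝ fun p : ℝ × ℝ => focusField k m s z p - focusField k m s z 0 := by
    refine ⟨fun p q => ?_, fun r p => ?_⟩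
    · cases z <;> ext <;> simp [focusField] <;> ring
    · cases z <;> ext <;> simp [focusField] <;> ring
  have h := (LinearMap.toContinuousLinearMap hlin.mk').lipschitz
  refine ⟨_, LipschitzWith.of_dist_le_mul (K := ‖LinearMap.toContinuousLinearMap hlin.mk'‖₊)
    fun p q => ?_⟩
  have := h.dist_le_mul p q
  simpa using this

/-- A periodic quantity cannot grow exponentially, unless it vanishes. -/
theorem eq_zero_of_periodic_of_hasDerivAt {N : ℝ → ℝ} {r T : ℝ} (hr : r ≠ 0) (hT : 0 < T)
    (hN : ∀ t, HasDerivAt N (r * N t) t) (hp : Function.Periodic N T) (t : ℝ) : N t = 0 := by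
  have hd : ∀ t, HasDerivAt (fun t => Real.exp (-r * t) * N t) 0 t := fun t => by
    have h1 : HasDerivAt (fun t : ℝ => Real.exp (-r * t)) (Real.exp (-r * t) * -r) t := by
      simpa using ((hasDerivAt_id t).const_mul (-r)).exp
    refine (h1.mul (hN t)).congr_deriv ?_
    ring
  have hc := is_const_of_deriv_eq_zero (fun t => (hd t).differentiableAt)
    (fun t => (hd t).deriv) (t + T) t
  simp only [hp t] at hc
  by_contra h0
  have := Real.exp_injective (mul_right_cancel₀ h0 hc)
  rcases mul_eq_zero.1 (by linarith : r * T = 0) with h | h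
  · exact hr h
  · exact hT.ne' h

/-- A nonconstant periodic crossing solution meets the switching lines. -/
theorem exists_forall_not_mem_region {k m s : ℝ} (hk : k ≠ 0) (hm : m ≠ 0) {γ : ℝ → ℝ × ℝ} {T : ℝ}
    (hγ : IsCrossingSolution (focusField k m s) γ) (hT : 0 < T) (hp : Function.Periodic γ T)
    (hne : ∃ t, γ t ≠ γ 0) : ∃ t, ∀ z, γ t ∉ PWZone.region z := by
  by_contra! hcon
  obtain ⟨z, hz0⟩ := hcon 0
  -- otherwise the solution stays in one zone, by connectedness
  have hz : ∀ t, γ t ∈ PWZone.region z := by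
    have hopen : ∀ z, IsOpen (γ ⁻¹' PWZone.region z) := fun z =>
      z.isOpen_region.preimage hγ.continuous
    have hclopen : IsClopen (γ ⁻¹' PWZone.region z) := by
      refine ⟨⟨?_⟩, hopen z⟩
      have : (γ ⁻¹' PWZone.region z)ᶜ = ⋃ z' ∈ {z' | z' ≠ z}, γ ⁻¹' PWZone.region z' := by
        ext t
        simp only [mem_compl_iff, mem_preimage, mem_iUnion, mem_ofPred_eq, exists_prop]
        constructor
        · intro h
          obtain ⟨z', hz'⟩ := hcon t
          exact ⟨z', fun he => h (he ▸ hz'), hz'⟩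
        · rintro ⟨z', hne, hz'⟩ h
          exact hne (PWZone.eq_of_mem_region hz' h)
      rw [this]
      exact isOpen_biUnion fun z' _ => hopen z'
    rcases isClopen_iff.1 hclopen with h | h
    · exact absurd (show (0 : ℝ) ∈ γ ⁻¹' PWZone.region z from hz0) (by simp [h])
    · exact fun t => (show t ∈ γ ⁻¹' PWZone.region z by simp [h])
  have hd : ∀ t, HasDerivAt γ (focusField k m s z (γ t)) t := fun t => hγ.inside z t (hz t)
  have h1 : ∀ t, HasDerivAt (fun t => (γ t).1) (focusField k m s z (γ t)).1 t := fun t =>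
    (hd t).fst
  have h2 : ∀ t, HasDerivAt (fun t => (γ t).2) (focusField k m s z (γ t)).2 t := fun t =>
    (hd t).snd
  obtain ⟨t₀, ht₀⟩ := hne
  cases z with
  | L =>
    have hN := eq_zero_of_periodic_of_hasDerivAt
      (N := fun t => ((γ t).1 + 5) ^ 2 + ((γ t).1 + 2 * (γ t).2 + 1) ^ 2) (r := 2 * k)
      (mul_ne_zero two_ne_zero hk) hT (fun t => by
        refine ((((h1 t).add_const 5).pow 2).add
          ((((h1 t).add ((h2 t).const_mul 2)).add_const 1).pow 2)).congr_deriv ?_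
        simp only [focusField, Pi.add_apply]
        push_cast
        ring) (fun t => by simp only [hp t])
    have hconst : ∀ t, γ t = (-5, 2) := fun t => by
      have h3 := hN t
      have h4 : (γ t).1 + 5 = 0 := by nlinarith [sq_nonneg ((γ t).1 + 2 * (γ t).2 + 1)]
      have h5 : (γ t).1 + 2 * (γ t).2 + 1 = 0 := by nlinarith [sq_nonneg ((γ t).1 + 5)]
      ext
      · simp only; linarith
      · simp only; linarith
    exact ht₀ ((hconst _).trans (hconst _).symm)
  | C =>
    have hN := eq_zero_of_periodic_of_hasDerivAt
      (N := fun t => (γ t).1 ^ 2 + (γ t).2 ^ 2) (r := 2 * m)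
      (mul_ne_zero two_ne_zero hm) hT (fun t => by
        refine (((h1 t).pow 2).add ((h2 t).pow 2)).congr_deriv ?_
        simp only [focusField]
        push_cast
        ring) (fun t => by simp only [hp t])
    have hconst : ∀ t, γ t = 0 := fun t => by
      have h3 := hN t
      ext
      · simp only [Prod.fst_zero]; nlinarith [sq_nonneg (γ t).1, sq_nonneg (γ t).2]
      · simp only [Prod.snd_zero]; nlinarith [sq_nonneg (γ t).1, sq_nonneg (γ t).2]
    exact ht₀ ((hconst _).trans (hconst _).symm)
  | R =>
    -- in the right zone the second coordinate decreases
    have hanti : StrictAnti fun t => (γ t).2 := by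
      refine strictAnti_of_deriv_neg fun t => ?_
      rw [(h2 t).deriv]
      have : 1 < (γ t).1 := hz t
      simp only [focusField]
      linarith
    have := hanti hT
    have hp0 := hp 0
    rw [zero_add] at hp0
    simp only [hp0, lt_self_iff_false] at this

/-- The function in terms of which a turn is a relation between separated variables. -/
noncomputable def turnPotential (k y : ℝ) : ℝ := Real.log (1 + y ^ 2) / 2 + k * Real.arctan y

theorem isTurn_iff {θ k y y' : ℝ} :
    IsTurn θ k y y' ↔ turnPotential k y' = turnPotential (-k) y + k * θ := by
  have h1 : 0 < 1 + y ^ 2 := by positivity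
  have h2 : 0 < 1 + y' ^ 2 := by positivity
  rw [IsTurn, ← Real.log_injOn_pos.eq_iff h2 (mul_pos h1 (Real.exp_pos _)),
    Real.log_mul h1.ne' (Real.exp_pos _).ne', Real.log_exp, turnPotential, turnPotential]
  constructor <;> intro h <;> linarith

theorem hasDerivAt_turnPotential (k y : ℝ) :
    HasDerivAt (turnPotential k) ((y + k) / (1 + y ^ 2)) y := by
  have h1 : 1 + y ^ 2 ≠ 0 := by positivity
  have h := ((((hasDerivAt_id y).pow 2).const_add 1).log (by simpa using h1)).div_const 2
  refine (h.add ((Real.hasDerivAt_arctan y).const_mul k)).congr_deriv ?_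
  simp only [id, Pi.pow_apply]
  field_simp
  push_cast
  ring

theorem continuous_turnPotential (k : ℝ) : Continuous (turnPotential k) :=
  continuous_iff_continuousAt.2 fun y => (hasDerivAt_turnPotential k y).continuousAt

theorem strictMonoOn_turnPotential (k : ℝ) : StrictMonoOn (turnPotential k) (Ici |k|) := by
  refine strictMonoOn_of_deriv_pos (convex_Ici _) (continuous_turnPotential k).continuousOn
    fun y hy => ?_
  rw [interior_Ici, mem_Ioi] at hy
  rw [(hasDerivAt_turnPotential k y).deriv]
  exact div_pos (by linarith [neg_abs_le k]) (by positivity)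

theorem IsTurn.mono {θ k x x' y y' : ℝ} (hx : IsTurn θ k x x') (hy : IsTurn θ k y y')
    (h0 : |k| < x) (h1 : |k| < x') (h2 : |k| < y') (hxy : x ≤ y) : x' ≤ y' := by
  rw [isTurn_iff] at hx hy
  rw [← (strictMonoOn_turnPotential k).le_iff_le h1.le h2.le, hx, hy]
  have h := (strictMonoOn_turnPotential (-k)).monotoneOn (a := x) (b := y)
    (by simpa using h0.le) (by simpa using h0.le.trans hxy) hxy
  linarith

theorem IsTurn.eventually_exists {θ k y y' l : ℝ} (h : IsTurn θ k y y') (hk : |k| ≤ l)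
    (hl : l < y') : ∀ᶠ x in 𝓝 y, ∃ x', l < x' ∧ IsTurn θ k x x' := by
  rw [isTurn_iff] at h
  obtain ⟨y₁, hy₁, hy₁'⟩ := exists_between hl
  have hm := strictMonoOn_turnPotential k
  have h1 : turnPotential k y₁ < turnPotential (-k) y + k * θ := by
    rw [← h]
    exact hm (hk.trans hy₁.le) (hk.trans hl.le) hy₁'
  have h2 : turnPotential (-k) y + k * θ < turnPotential k (y' + 1) := by
    rw [← h]
    exact hm (hk.trans hl.le) (show |k| ≤ y' + 1 by linarith) (by linarith)
  have hc : Continuous fun x => turnPotential (-k) x + k * θ :=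
    (continuous_turnPotential _).add continuous_const
  filter_upwards [hc.continuousAt.eventually (Ioo_mem_nhds h1 h2)] with x hx
  obtain ⟨x', hx', he⟩ := intermediate_value_Icc (by linarith : y₁ ≤ y' + 1)
    (continuous_turnPotential k).continuousOn (Ioo_subset_Icc_self hx)
  exact ⟨x', hy₁.trans_le hx'.1, isTurn_iff.2 he⟩

/-- A monotone relation on a nonempty compact set of reals, in which every point has a successor,
has a fixed point. -/
theorem exists_fixed_of_monotone {A : Set ℝ} (hc : IsCompact A) (hne : A.Nonempty)
    {R : ℝ → ℝ → Prop} (hR : ∀ x ∈ A, ∃ y ∈ A, R x y)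
    (hmono : ∀ x ∈ A, ∀ x' ∈ A, ∀ y y', R x y → R x' y' → x ≤ x' → y ≤ y') :
    ∃ x ∈ A, R x x := by
  choose! f hfA hf using hR
  set B := {x ∈ A | x ≤ f x} with hB
  have hBA : B ⊆ A := fun x hx => hx.1
  obtain ⟨l, hl, hl'⟩ := hc.exists_isLeast hne
  have hBne : B.Nonempty := ⟨l, hl, hl' (hfA l hl)⟩
  have hbdd : BddAbove B := hc.bddAbove.mono hBA
  have hs : sSup B ∈ A := hc.isClosed.closure_subset_iff.2 hBA (csSup_mem_closure hBne hbdd)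
  have h1 : sSup B ≤ f (sSup B) := csSup_le hBne fun x hx =>
    hx.2.trans (hmono x hx.1 _ hs _ _ (hf x hx.1) (hf _ hs) (le_csSup hbdd hx))
  have h2 : f (sSup B) ≤ sSup B :=
    le_csSup hbdd ⟨hfA _ hs, hmono _ hs _ (hfA _ hs) _ _ (hf _ hs) (hf _ (hfA _ hs)) h1⟩
  exact ⟨_, hs, by simpa only [le_antisymm h2 h1] using hf _ hs⟩

/-- A loop is a limit cycle if no other loop is close to it. Any periodic orbit near the loop
crosses the switching lines near its corners; the first return map to the line `x = 1` is monotone, so the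
orbit contains a fixed point of this map, that is, the corner of a loop. -/
theorem IsLoop.isCrossingLimitCycle {k m s a c d : ℝ} (h : IsLoop k m s a c d) (hk : k ≠ 0)
    (hm : m ≠ 0) (huniq : ∀ᶠ q : ℝ × ℝ × ℝ in 𝓝 (a, c, d),
      IsLoop k m s q.1 q.2.1 q.2.2 → q = (a, c, d)) :
    IsCrossingLimitCycle (focusField k m s) (loopSet k m s a c d) := by
  refine ⟨h.isCrossingPeriodicOrbit, ?_⟩
  have hX := exists_lipschitzWith_focusField k m s
  have hm0 : 0 ≤ |m| := abs_nonneg m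
  have hk0 : 0 ≤ |k| := abs_nonneg k
  rw [nhds_prod_eq, nhds_prod_eq, eventually_prod_iff] at huniq
  obtain ⟨Pa, hPa, Pcd, hPcd, huniq⟩ := huniq
  obtain ⟨Pc, hPc, Pd, hPd, hcd⟩ := eventually_prod_iff.1 hPcd
  -- neighbourhoods of the corners in which the transitions exist
  have ea : ∀ᶠ y in 𝓝 a, Pa y ∧ |m| < y ∧ 0 < y + s ∧ |m| < y + 2 * s :=
    hPa.and ((lt_mem_nhds h.lt_a).and
      (((continuous_id.add continuous_const).continuousAt.eventually
        (lt_mem_nhds h.pos_right)).and ((continuous_id.add continuous_const).continuousAt.eventually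
        (lt_mem_nhds h.lt_b))))
  have eb : ∀ᶠ y in 𝓝 (a + 2 * s), |m| < y ∧ s < y ∧
      ∃ c', max |m| (2 * |k|) < c' ∧ IsTurn Real.pi m y c' :=
    (lt_mem_nhds h.lt_b).and ((lt_mem_nhds (by linarith [h.pos_right])).and
      (h.lower.eventually_exists (le_max_left _ _) (max_lt h.lt_c (by linarith [h.lt_left_c]))))
  have ec : ∀ᶠ y in 𝓝 c, Pc y ∧ |k| < y ∧ |m| < 2 * y ∧
      ∃ d', max |k| (|m| / 2) < d' ∧ IsTurn (2 * Real.pi) k y d' :=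
    hPc.and ((lt_mem_nhds h.lt_left_c).and
      (((continuous_const.mul continuous_id).continuousAt.eventually (lt_mem_nhds h.lt_c)).and
        (h.left.eventually_exists (le_max_left _ _) (max_lt h.lt_left_d (by linarith [h.lt_d])))))
  have ed : ∀ᶠ y in 𝓝 d, Pd y ∧ |k| < y ∧ |m| < 2 * y ∧
      ∃ a', |m| < a' ∧ IsTurn Real.pi m (2 * y) a' :=
    hPd.and ((lt_mem_nhds h.lt_left_d).and
      (((continuous_const.mul continuous_id).continuousAt.eventually (lt_mem_nhds h.lt_d)).and
        ((continuous_const.mul continuous_id).continuousAt.eventually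
          (h.upper.eventually_exists le_rfl h.lt_a))))
  obtain ⟨Ja, hJa, hJao, haJ⟩ := eventually_nhds_iff.1 ea
  obtain ⟨Jb, hJb, hJbo, hbJ⟩ := eventually_nhds_iff.1 eb
  obtain ⟨Jc, hJc, hJco, hcJ⟩ := eventually_nhds_iff.1 ec
  obtain ⟨Jd, hJd, hJdo, hdJ⟩ := eventually_nhds_iff.1 ed
  refine ⟨{p | (p.1 = 1 → p.2 ∈ Ja ∨ -p.2 ∈ Jb) ∧ (p.1 = -1 → -p.2 / 2 ∈ Jc ∨ p.2 / 2 ∈ Jd)},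
    ?_, fun p hp => ?_, ?_⟩
  · have hne : ∀ r : ℝ, IsOpen {p : ℝ × ℝ | p.1 ≠ r} := fun r =>
      isOpen_ne_fun continuous_fst continuous_const
    refine IsOpen.inter ?_ ?_ <;> simp only [imp_iff_not_or]
    · exact (hne 1).union ((hJao.preimage continuous_snd).union
        (hJbo.preimage continuous_snd.neg))
    · exact (hne (-1)).union ((hJco.preimage (continuous_snd.neg.div_const 2)).union
        (hJdo.preimage (continuous_snd.div_const 2)))
  · have hcorner : (∀ z, p ∉ PWZone.region z) → _ := h.eq_corner hp
    have hsub : p.1 = 1 ∨ p.1 = -1 → ∀ z, p ∉ PWZone.region z := fun he z hz => by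
      have := PWZone.fst_ne_of_mem_region hz
      tauto
    constructor
    · intro he
      rcases hcorner (hsub (.inl he)) with rfl | rfl | rfl | rfl
      · exact .inl haJ
      · exact .inr (by simpa using hbJ)
      · norm_num at he
      · norm_num at he
    · intro he
      rcases hcorner (hsub (.inr he)) with rfl | rfl | rfl | rfl
      · norm_num at he
      · norm_num at he
      · exact .inl (by simpa using hcJ)
      · exact .inr (by simpa using hdJ)
  · rintro _ ⟨γ, T, hγ, hT, hp, hne, rfl⟩ hU
    have hU1 : ∀ t y, γ t = (1, y) → y ∈ Ja ∨ -y ∈ Jb := fun t y ht => by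
      have := (hU ⟨t, rfl⟩).1
      rw [ht] at this
      exact this rfl
    have hU2 : ∀ t y, γ t = (-1, y) → -y / 2 ∈ Jc ∨ y / 2 ∈ Jd := fun t y ht => by
      have := (hU ⟨t, rfl⟩).2
      rw [ht] at this
      exact this rfl
    -- the four transitions
    have sR : ∀ t y, γ t = (1, y) → y ∈ Ja → ∃ t', γ t' = (1, -(y + 2 * s)) ∧ y + 2 * s ∈ Jb := by
      intro t y ht hy
      obtain ⟨-, h1, h2, h3⟩ := hJa y hy
      have h4 := (isZoneArc_arcR k m h2).eq_of_isTransitAt hX (isTransitAt_CR k h2 h1) hγ ht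
      refine ⟨_, h4, ?_⟩
      rcases hU1 _ _ h4 with h5 | h5
      · linarith [(hJa _ h5).2.1]
      · simpa using h5
    have sC : ∀ t y, γ t = (1, -y) → y ∈ Jb → ∃ t' c', γ t' = (-1, -(2 * c')) ∧ c' ∈ Jc ∧
        IsTurn Real.pi m y (2 * c') := by
      intro t y ht hy
      obtain ⟨h1, h2, c', h3, h4⟩ := hJb y hy
      have h5 : |m| < c' := (le_max_left _ _).trans_lt h3
      have h6 := (isZoneArc_lower k s h1 h5 h4).eq_of_isTransitAt hX (isTransitAt_RC k h2 h1) hγ ht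
      refine ⟨_, c' / 2, by rw [h6]; ring_nf, ?_, by rwa [mul_div_cancel₀ _ two_ne_zero]⟩
      rcases hU2 _ _ h6 with h7 | h7
      · simpa using h7
      · linarith [(hJd _ h7).2.2.1]
    have sL : ∀ t y, γ t = (-1, -(2 * y)) → y ∈ Jc → ∃ t' d', γ t' = (-1, 2 * d') ∧ d' ∈ Jd ∧
        IsTurn (2 * Real.pi) k y d' := by
      intro t y ht hy
      obtain ⟨-, h1, h2, d', h3, h4⟩ := hJc y hy
      have h5 : |k| < d' := (le_max_left _ _).trans_lt h3
      have h6 := (isZoneArc_arcL m s h1 h5 h4).eq_of_isTransitAt hX (isTransitAt_CL s h1 h2) hγ ht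
      refine ⟨_, d', h6, ?_, h4⟩
      rcases hU2 _ _ h6 with h7 | h7
      · linarith [(hJc _ h7).2.1]
      · simpa using h7
    have sU : ∀ t y, γ t = (-1, 2 * y) → y ∈ Jd → ∃ t' a', γ t' = (1, a') ∧ a' ∈ Ja ∧
        IsTurn Real.pi m (2 * y) a' := by
      intro t y ht hy
      obtain ⟨-, h1, h2, a', h3, h4⟩ := hJd y hy
      have h6 := (isZoneArc_upper k s h2 h3 h4).eq_of_isTransitAt hX (isTransitAt_LC s h1 h2) hγ ht
      refine ⟨_, a', h6, ?_, h4⟩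
      rcases hU1 _ _ h6 with h7 | h7
      · exact h7
      · linarith [(hJb _ h7).1]
    -- the set of crossings of the line `x = 1` from left to right
    set A : Set ℝ := {y | y ∈ Ja ∧ (1, y) ∈ range γ} with hA
    have hcomp : IsCompact (range γ) := by
      rw [← hp.image_Icc hT 0]
      exact isCompact_Icc.image hγ.continuous
    have hAcomp : IsCompact A := by
      -- these crossings lie above `|m| > 0`, the crossings in the other direction below `0`
      have hAeq : A = Prod.snd '' (range γ ∩ {p | p.1 = 1}) ∩ Ici |m| := by
        ext y
        constructor
        · exact fun hy => ⟨⟨(1, y), ⟨hy.2, rfl⟩, rfl⟩, (hJa y hy.1).2.1.le⟩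
        · rintro ⟨⟨⟨x, y⟩, ⟨⟨t, ht⟩, hx⟩, rfl⟩, hy⟩
          obtain rfl : x = 1 := hx
          refine ⟨(hU1 t y ht).resolve_right fun hb => ?_, t, ht⟩
          have := (hJb _ hb).1
          rw [mem_Ici] at hy
          linarith [abs_pos.2 hm]
      rw [hAeq]
      exact ((hcomp.inter_right (isClosed_eq continuous_fst continuous_const)).image
        continuous_snd).inter_right isClosed_Ici
    have hAne : A.Nonempty := by
      have fromD : ∀ t y, γ t = (-1, 2 * y) → y ∈ Jd → A.Nonempty := fun t y ht hy => by
        obtain ⟨t', a', h1, h2, -⟩ := sU t y ht hy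
        exact ⟨a', h2, t', h1⟩
      have fromC : ∀ t y, γ t = (-1, -(2 * y)) → y ∈ Jc → A.Nonempty := fun t y ht hy => by
        obtain ⟨t', d', h1, h2, -⟩ := sL t y ht hy
        exact fromD t' d' h1 h2
      obtain ⟨t, ht⟩ := exists_forall_not_mem_region hk hm hγ hT hp hne
      rcases PWZone.exists_mem_region_or (γ t) with ⟨z, hz⟩ | hl | hr
      · exact absurd hz (ht z)
      · have hl' : γ t = (-1, (γ t).2) := Prod.ext hl rfl
        rcases hU2 _ _ hl' with h1 | h1
        · exact fromC t _ (by rw [hl']; ring_nf) h1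
        · exact fromD t _ (by rw [hl']; ring_nf) h1
      · have hr' : γ t = (1, (γ t).2) := Prod.ext hr rfl
        rcases hU1 _ _ hr' with h1 | h1
        · exact ⟨_, h1, t, hr'⟩
        · obtain ⟨t', c', h2, h3, -⟩ := sC t _ (by rw [hr', neg_neg]) h1
          exact fromC t' c' h2 h3
    obtain ⟨y, ⟨hyJ, t, ht⟩, c', hc', d', hd', h1, h2, h3⟩ := exists_fixed_of_monotone hAcomp hAne
      (R := fun y y' => ∃ c' ∈ Jc, ∃ d' ∈ Jd, IsTurn Real.pi m (y + 2 * s) (2 * c') ∧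
        IsTurn (2 * Real.pi) k c' d' ∧ IsTurn Real.pi m (2 * d') y' ∧ |m| < y')
      (by
        rintro y ⟨hy, t, ht⟩
        obtain ⟨t₁, h1, h2⟩ := sR t y ht hy
        obtain ⟨t₂, c', h3, h4, h5⟩ := sC t₁ _ h1 h2
        obtain ⟨t₃, d', h6, h7, h8⟩ := sL t₂ _ h3 h4
        obtain ⟨t₄, a', h9, h10, h11⟩ := sU t₃ _ h6 h7
        exact ⟨a', ⟨h10, t₄, h9⟩, c', h4, d', h7, h5, h8, h11, (hJa _ h10).2.1⟩)
      (by
        rintro x hx x' hx' y y' ⟨c₁, hc₁, d₁, hd₁, h1, h2, h3, h4⟩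
          ⟨c₂, hc₂, d₂, hd₂, g1, g2, g3, g4⟩ hxx
        obtain ⟨-, -, -, hx1⟩ := hJa x hx.1
        obtain ⟨-, hc1, hc2, -⟩ := hJc c₁ hc₁
        obtain ⟨-, hc3, hc4, -⟩ := hJc c₂ hc₂
        obtain ⟨-, hd1, hd2, -⟩ := hJd d₁ hd₁
        obtain ⟨-, hd3, hd4, -⟩ := hJd d₂ hd₂
        have e1 := h1.mono g1 hx1 hc2 hc4 (by linarith)
        have e2 := h2.mono g2 hc1 hd1 hd3 (by linarith)
        exact h3.mono g3 hd2 h4 g4 (by linarith))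
    obtain ⟨p1, p2, p3, p4⟩ := hJa y hyJ
    obtain ⟨q1, q2, q3, -⟩ := hJc c' hc'
    obtain ⟨r1, r2, r3, -⟩ := hJd d' hd'
    have hya := huniq p1 (hcd q1 r1) ⟨p3, p2, p4, q3, r3, q2, r2, h1, h2, h3.1⟩
    obtain rfl : y = a := congrArg Prod.fst hya
    obtain ⟨δ, S, hδ, hS, hδp, hδ0, hδr⟩ := h.exists_periodic
    rw [← hδr]
    exact hγ.range_eq_of_eq hX hδ hT hS hp hδp (ht.trans hδ0.symm)

/-! ### Bifurcation from a simple zero of the Melnikov function -/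

/-- The entire function `(exp z - 1) / z`. -/
noncomputable def expSlope : ℝ → ℝ := dslope Real.exp 0

theorem mul_expSlope (z : ℝ) : z * expSlope z = Real.exp z - 1 := by
  simpa [expSlope] using sub_smul_dslope Real.exp 0 z

theorem expSlope_zero : expSlope 0 = 1 := by simp [expSlope, dslope_same]

theorem contDiffAt_expSlope : ContDiffAt ℝ 1 expSlope 0 := by
  obtain ⟨p, hp⟩ := (analyticAt_rexp (x := 0))
  exact (hp.has_fpower_series_dslope_fslope).analyticAt.contDiffAt

theorem sub_mul_expSlope_eq_zero_iff {ε P F w : ℝ} (hε : ε ≠ 0) :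
    F - w * (P * expSlope (ε * P)) = 0 ↔ ε * F = w * (Real.exp (ε * P) - 1) := by
  rw [← mul_expSlope]
  constructor
  · intro h
    linear_combination ε * h
  · intro h
    apply mul_left_cancel₀ hε
    linear_combination h

/-- The first-order Melnikov function of the perturbation, up to a constant factor. -/
noncomputable def melnikov (q p r h : ℝ) : ℝ :=
  r * h + p * (1 + h ^ 2) * (Real.pi - 2 * Real.arctan h) +
    q * (4 + h ^ 2) * (Real.pi - Real.arctan (h / 2))

/-- The closing conditions of a loop, divided by `ε`. The variables are `ε`, the height `a` of the
first corner, and the scaled differences `γ` and `δ` between the heights of the two corners on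
`x = -1` and `a`. The first component is `ε` itself. -/
noncomputable def closingMap (q p r : ℝ) (x : ℝ × ℝ × ℝ × ℝ) : ℝ × ℝ × ℝ × ℝ :=
  (x.1,
    2 * x.2.1 * (x.2.2.1 - 2 * r) + x.1 * (x.2.2.1 ^ 2 - 4 * r ^ 2) -
      (1 + (x.2.1 + 2 * (x.1 * r)) ^ 2) *
      (2 * p * (Real.pi - Real.arctan (x.2.1 + 2 * (x.1 * r)) -
        Real.arctan (x.2.1 + x.1 * x.2.2.1)) *
      expSlope (x.1 * (2 * p * (Real.pi - Real.arctan (x.2.1 + 2 * (x.1 * r)) -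
        Real.arctan (x.2.1 + x.1 * x.2.2.1))))),
    2 * x.2.1 * (x.2.2.2 - x.2.2.1) + x.1 * (x.2.2.2 ^ 2 - x.2.2.1 ^ 2) -
      (4 + (x.2.1 + x.1 * x.2.2.1) ^ 2) *
      (2 * q * (2 * Real.pi - Real.arctan ((x.2.1 + x.1 * x.2.2.1) / 2) -
        Real.arctan ((x.2.1 + x.1 * x.2.2.2) / 2)) *
      expSlope (x.1 * (2 * q * (2 * Real.pi - Real.arctan ((x.2.1 + x.1 * x.2.2.1) / 2) -
        Real.arctan ((x.2.1 + x.1 * x.2.2.2) / 2))))),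
    -2 * x.2.1 * x.2.2.2 - x.1 * x.2.2.2 ^ 2 -
      (1 + (x.2.1 + x.1 * x.2.2.2) ^ 2) *
      (2 * p * (Real.pi - Real.arctan (x.2.1 + x.1 * x.2.2.2) - Real.arctan x.2.1) *
      expSlope (x.1 * (2 * p * (Real.pi - Real.arctan (x.2.1 + x.1 * x.2.2.2) -
        Real.arctan x.2.1)))))

/-- The closing conditions of a loop, without the inequalities. -/
def ClosesUp (k m s a c d : ℝ) : Prop :=
  IsTurn Real.pi m (a + 2 * s) (2 * c) ∧ IsTurn (2 * Real.pi) k c d ∧ IsTurn Real.pi m (2 * d) a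

theorem closingMap_eq_iff {q p r ε a γ δ : ℝ} (hε : ε ≠ 0) :
    closingMap q p r (ε, a, γ, δ) = (ε, 0, 0, 0) ↔
      ClosesUp (ε * q) (ε * p) (ε * r) a ((a + ε * γ) / 2) ((a + ε * δ) / 2) := by
  simp only [closingMap, Prod.mk.injEq, true_and, ClosesUp, sub_mul_expSlope_eq_zero_iff hε,
    IsTurn, mul_div_cancel₀ _ (two_ne_zero (α := ℝ))]
  refine and_congr ?_ (and_congr ?_ ?_)
  · rw [show 2 * (ε * p) * (Real.pi - Real.arctan (a + 2 * (ε * r)) - Real.arctan (a + ε * γ)) =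
      ε * (2 * p * (Real.pi - Real.arctan (a + 2 * (ε * r)) - Real.arctan (a + ε * γ))) by ring]
    constructor <;> intro h <;> linear_combination h
  · rw [show 2 * (ε * q) * (2 * Real.pi - Real.arctan ((a + ε * γ) / 2) -
      Real.arctan ((a + ε * δ) / 2)) = ε * (2 * q * (2 * Real.pi - Real.arctan ((a + ε * γ) / 2) -
      Real.arctan ((a + ε * δ) / 2))) by ring]
    constructor <;> intro h
    · linear_combination h / 4
    · linear_combination 4 * h
  · rw [show 2 * (ε * p) * (Real.pi - Real.arctan (a + ε * δ) - Real.arctan a) =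
      ε * (2 * p * (Real.pi - Real.arctan (a + ε * δ) - Real.arctan a)) by ring]
    constructor <;> intro h <;> linear_combination h

theorem contDiffAt_closingMap (q p r : ℝ) {x : ℝ × ℝ × ℝ × ℝ} (hx : x.1 = 0) :
    ContDiffAt ℝ 1 (closingMap q p r) x := by
  have harc : ContDiff ℝ 1 Real.arctan := Real.contDiff_arctan
  have hslope : ∀ f : ℝ × ℝ × ℝ × ℝ → ℝ, ContDiffAt ℝ 1 f x →
      ContDiffAt ℝ 1 (fun y => expSlope (y.1 * f y)) x := fun f hf => by
    have h0 : ContDiffAt ℝ 1 expSlope (x.1 * f x) := by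
      rw [hx, zero_mul]
      exact contDiffAt_expSlope
    exact h0.comp x (contDiffAt_fst.mul hf)
  have h1 : ContDiffAt ℝ 1 (fun x : ℝ × ℝ × ℝ × ℝ =>
      2 * p * (Real.pi - Real.arctan (x.2.1 + 2 * (x.1 * r)) -
        Real.arctan (x.2.1 + x.1 * x.2.2.1))) x := by fun_prop
  have h2 : ContDiffAt ℝ 1 (fun x : ℝ × ℝ × ℝ × ℝ =>
      2 * q * (2 * Real.pi - Real.arctan ((x.2.1 + x.1 * x.2.2.1) / 2) -
        Real.arctan ((x.2.1 + x.1 * x.2.2.2) / 2))) x := by fun_prop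
  have h3 : ContDiffAt ℝ 1 (fun x : ℝ × ℝ × ℝ × ℝ =>
      2 * p * (Real.pi - Real.arctan (x.2.1 + x.1 * x.2.2.2) - Real.arctan x.2.1)) x := by fun_prop
  have e1 := hslope _ h1
  have e2 := hslope _ h2
  have e3 := hslope _ h3
  unfold closingMap
  refine contDiffAt_fst.prodMk (ContDiffAt.prodMk ?_ (ContDiffAt.prodMk ?_ ?_))
  · exact (by fun_prop : ContDiffAt ℝ 1 (fun x : ℝ × ℝ × ℝ × ℝ =>
      2 * x.2.1 * (x.2.2.1 - 2 * r) + x.1 * (x.2.2.1 ^ 2 - 4 * r ^ 2)) x).sub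
      (ContDiffAt.mul (by fun_prop) (h1.mul e1))
  · exact (by fun_prop : ContDiffAt ℝ 1 (fun x : ℝ × ℝ × ℝ × ℝ =>
      2 * x.2.1 * (x.2.2.2 - x.2.2.1) + x.1 * (x.2.2.2 ^ 2 - x.2.2.1 ^ 2)) x).sub
      (ContDiffAt.mul (by fun_prop) (h2.mul e2))
  · exact (by fun_prop : ContDiffAt ℝ 1 (fun x : ℝ × ℝ × ℝ × ℝ =>
      -2 * x.2.1 * x.2.2.2 - x.1 * x.2.2.2 ^ 2) x).sub
      (ContDiffAt.mul (by fun_prop) (h3.mul e3))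

theorem closingMap_zero (q p r a γ δ : ℝ) :
    closingMap q p r (0, a, γ, δ) =
      (0, 2 * a * (γ - 2 * r) - (1 + a ^ 2) * (2 * p * (Real.pi - 2 * Real.arctan a)),
        2 * a * (δ - γ) - (4 + a ^ 2) * (4 * q * (Real.pi - Real.arctan (a / 2))),
        -2 * a * δ - (1 + a ^ 2) * (2 * p * (Real.pi - 2 * Real.arctan a))) := by
  simp only [closingMap, zero_mul, mul_zero, add_zero, expSlope_zero, mul_one, sub_zero]
  refine Prod.ext rfl (Prod.ext ?_ (Prod.ext ?_ ?_)) <;> simp only <;> ring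

/-- At a simple zero of the Melnikov function the linearized closing conditions are nondegenerate:
the sum of the three conditions at `ε = 0` is a multiple of the Melnikov function. -/
theorem fderiv_closingMap_injective {q p r h μ γ δ : ℝ} (hh : h ≠ 0) (hμ : μ ≠ 0)
    (hd : HasDerivAt (melnikov q p r) μ h) :
    Function.Injective (fderiv ℝ (closingMap q p r) (0, h, γ, δ)) := by
  have hf := ((contDiffAt_closingMap q p r (x := (0, h, γ, δ)) rfl).differentiableAt
    one_ne_zero).hasFDerivAt
  set D := fderiv ℝ (closingMap q p r) (0, h, γ, δ) with hD
  rw [injective_iff_map_eq_zero]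
  rintro ⟨e, α, g, d⟩ hv
  have h1 := ((hasFDerivAt_fst (𝕜 := ℝ) (p := closingMap q p r (0, h, γ, δ))).comp _ hf).unique
    (hasFDerivAt_fst (𝕜 := ℝ) (p := ((0, h, γ, δ) : ℝ × ℝ × ℝ × ℝ)))
  have he : e = 0 := by
    have := congrArg (fun L => L (e, α, g, d)) h1
    simp only [ContinuousLinearMap.comp_apply, hv] at this
    simpa using this.symm
  subst he
  have hline : HasDerivAt (fun t : ℝ => ((0, h + t * α, γ + t * g, δ + t * d) : ℝ × ℝ × ℝ × ℝ))
      (0, α, g, d) 0 := by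
    have hl : ∀ u v : ℝ, HasDerivAt (fun t : ℝ => u + t * v) v 0 := fun u v => by
      simpa using ((hasDerivAt_id (0 : ℝ)).mul_const v).const_add u
    exact (hasDerivAt_const _ _).prodMk ((hl _ _).prodMk ((hl _ _).prodMk (hl _ _)))
  have hcomp : HasDerivAt (fun t : ℝ => closingMap q p r (0, h + t * α, γ + t * g, δ + t * d))
      0 0 := by
    rw [← hv]
    refine HasFDerivAt.comp_hasDerivAt (l := closingMap q p r) (l' := D) (0 : ℝ) ?_ hline
    simpa using hf
  simp only [closingMap_zero] at hcomp
  have k1 := hcomp.snd.fst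
  have k2 := hcomp.snd.snd.fst
  have k3 := hcomp.snd.snd.snd
  simp only [Prod.fst_zero, Prod.snd_zero] at k1 k2 k3
  have hα : α = 0 := by
    have hl : HasDerivAt (fun t : ℝ => h + t * α) α 0 := by
      simpa using ((hasDerivAt_id (0 : ℝ)).mul_const α).const_add h
    have hm : HasDerivAt (fun t => -4 * melnikov q p r (h + t * α)) (-4 * (μ * α)) 0 := by
      refine (HasDerivAt.comp (0 : ℝ) (h₂ := melnikov q p r) ?_ hl).const_mul (-4)
      simpa using hd
    have hsum := (k1.add k2).add k3
    have := hm.unique (hsum.congr_of_eventuallyEq (.of_forall fun t => by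
      simp only [melnikov, Pi.add_apply]
      ring))
    simpa [hμ] using this
  subst hα
  have hd0 : d = 0 := by
    have : HasDerivAt (fun t : ℝ => -2 * h * (δ + t * d) -
        (1 + h ^ 2) * (2 * p * (Real.pi - 2 * Real.arctan h))) (-2 * h * d) 0 := by
      have hl : HasDerivAt (fun t : ℝ => δ + t * d) d 0 := by
        simpa using ((hasDerivAt_id (0 : ℝ)).mul_const d).const_add δ
      exact (hl.const_mul (-2 * h)).sub_const _
    have := this.unique (by simpa using k3)
    simpa [hh] using this
  have hg0 : g = 0 := by
    have : HasDerivAt (fun t : ℝ => 2 * h * (γ + t * g - 2 * r) -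
        (1 + h ^ 2) * (2 * p * (Real.pi - 2 * Real.arctan h))) (2 * h * g) 0 := by
      have hl : HasDerivAt (fun t : ℝ => γ + t * g) g 0 := by
        simpa using ((hasDerivAt_id (0 : ℝ)).mul_const g).const_add γ
      exact ((hl.sub_const _).const_mul (2 * h)).sub_const _
    have := this.unique (by simpa using k1)
    simpa [hh] using this
  subst hd0 hg0
  rfl

/-- Every simple zero of the Melnikov function is continued by a branch of closing data that are
locally unique for each `ε`. -/
theorem exists_branch {q p r h μ : ℝ} (hh : h ≠ 0) (hμ : μ ≠ 0) (h0 : melnikov q p r h = 0)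
    (hd : HasDerivAt (melnikov q p r) μ h) :
    ∃ x : ℝ → ℝ × ℝ × ℝ, Tendsto x (𝓝[>] 0) (𝓝 (h, h / 2, h / 2)) ∧
      ∀ᶠ ε in 𝓝[>] 0, ClosesUp (ε * q) (ε * p) (ε * r) (x ε).1 (x ε).2.1 (x ε).2.2 ∧
        ∀ᶠ y in 𝓝 (x ε), ClosesUp (ε * q) (ε * p) (ε * r) y.1 y.2.1 y.2.2 → y = x ε := by
  -- `x₀` solves the closing conditions at `ε = 0`
  set P := (1 + h ^ 2) * (p * (Real.pi - 2 * Real.arctan h)) with hP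
  set x₀ : ℝ × ℝ × ℝ × ℝ := (0, h, 2 * r + P / h, -P / h) with hx₀
  have hc := contDiffAt_closingMap q p r (x := x₀) rfl
  have hval : closingMap q p r x₀ = 0 := by
    rw [hx₀, closingMap_zero]
    have e1 : h * (P / h) = P := mul_div_cancel₀ _ hh
    have e2 : h * (-P / h) = -P := mul_div_cancel₀ _ hh
    rw [melnikov] at h0
    refine Prod.ext rfl (Prod.ext ?_ (Prod.ext ?_ ?_))
    · simp only [Prod.snd_zero, Prod.fst_zero]
      linear_combination 2 * e1 + 2 * hP
    · simp only [Prod.snd_zero, Prod.fst_zero]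
      linear_combination 2 * e2 - 2 * e1 - 4 * h0 - 4 * hP
    · simp only [Prod.snd_zero]
      linear_combination -2 * e2 + 2 * hP
  have hinj : Function.Injective (fderiv ℝ (closingMap q p r) x₀) :=
    fderiv_closingMap_injective hh hμ hd
  set f' := (LinearEquiv.ofInjectiveEndo
    (fderiv ℝ (closingMap q p r) x₀ : (ℝ × ℝ × ℝ × ℝ) →ₗ[ℝ] (ℝ × ℝ × ℝ × ℝ))
      hinj).toContinuousLinearEquiv with hf'
  have hstrict : HasStrictFDerivAt (closingMap q p r)
      (f' : (ℝ × ℝ × ℝ × ℝ) →L[ℝ] (ℝ × ℝ × ℝ × ℝ)) x₀ := by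
    have hfe : (f' : (ℝ × ℝ × ℝ × ℝ) →L[ℝ] (ℝ × ℝ × ℝ × ℝ)) = fderiv ℝ (closingMap q p r) x₀ :=
      ContinuousLinearMap.ext fun _ => rfl
    rw [hfe]
    exact hc.hasStrictFDerivAt one_ne_zero
  set Φ := hstrict.toOpenPartialHomeomorph (closingMap q p r) with hΦ
  have hΦc : ∀ x, Φ x = closingMap q p r x := fun x => rfl
  have hsrc : x₀ ∈ Φ.source := hstrict.mem_toOpenPartialHomeomorph_source
  have htgt : (0 : ℝ × ℝ × ℝ × ℝ) ∈ Φ.target := by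
    have := Φ.map_source hsrc
    rwa [hΦc, hval] at this
  have hsymm0 : Φ.symm 0 = x₀ := by
    have := Φ.left_inv hsrc
    rwa [hΦc, hval] at this
  have hι : Tendsto (fun ε : ℝ => ((ε, 0, 0, 0) : ℝ × ℝ × ℝ × ℝ)) (𝓝[>] 0) (𝓝 0) := by
    have : Continuous fun ε : ℝ => ((ε, 0, 0, 0) : ℝ × ℝ × ℝ × ℝ) := by fun_prop
    exact (this.tendsto 0).mono_left nhdsWithin_le_nhds
  set y : ℝ → ℝ × ℝ × ℝ × ℝ := fun ε => Φ.symm (ε, 0, 0, 0) with hy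
  have hyt : Tendsto y (𝓝[>] 0) (𝓝 x₀) := by
    have := (Φ.continuousAt_symm htgt).tendsto
    rw [hsymm0] at this
    exact this.comp hι
  refine ⟨fun ε => ((y ε).2.1, ((y ε).2.1 + ε * (y ε).2.2.1) / 2,
    ((y ε).2.1 + ε * (y ε).2.2.2) / 2), ?_, ?_⟩
  · have hε : Tendsto (fun ε : ℝ => ε) (𝓝[>] 0) (𝓝 0) := tendsto_id.mono_left nhdsWithin_le_nhds
    have t := hyt.prodMk_nhds hε
    have hcont : Continuous fun z : (ℝ × ℝ × ℝ × ℝ) × ℝ => ((z.1.2.1,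
      (z.1.2.1 + z.2 * z.1.2.2.1) / 2, (z.1.2.1 + z.2 * z.1.2.2.2) / 2) : ℝ × ℝ × ℝ) := by fun_prop
    have := (hcont.tendsto (x₀, 0)).comp t
    simpa [hx₀, Function.comp_def] using this
  · filter_upwards [hι.eventually (Φ.open_target.mem_nhds htgt), self_mem_nhdsWithin] with ε hε hpos
    have hε0 : ε ≠ 0 := (show (0 : ℝ) < ε from hpos).ne'
    have hys : y ε ∈ Φ.source := Φ.map_target hε
    have hyv : closingMap q p r (y ε) = (ε, 0, 0, 0) := Φ.right_inv hε
    have hy1 : (y ε).1 = ε := congrArg Prod.fst hyv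
    have hye : y ε = (ε, (y ε).2.1, (y ε).2.2.1, (y ε).2.2.2) := Prod.ext hy1 rfl
    refine ⟨?_, ?_⟩
    · rw [← closingMap_eq_iff hε0, ← hye]
      exact hyv
    · -- for a fixed `ε`, the scaled variables depend continuously on the corners
      have hcont : Continuous fun w : ℝ × ℝ × ℝ =>
          ((ε, w.1, (2 * w.2.1 - w.1) / ε, (2 * w.2.2 - w.1) / ε) : ℝ × ℝ × ℝ × ℝ) := by fun_prop
      have hat := hcont.tendsto ((y ε).2.1, ((y ε).2.1 + ε * (y ε).2.2.1) / 2,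
        ((y ε).2.1 + ε * (y ε).2.2.2) / 2)
      have hback : (ε, (y ε).2.1, (2 * (((y ε).2.1 + ε * (y ε).2.2.1) / 2) - (y ε).2.1) / ε,
          (2 * (((y ε).2.1 + ε * (y ε).2.2.2) / 2) - (y ε).2.1) / ε) = y ε := by
        conv_rhs => rw [hye]
        refine Prod.ext rfl (Prod.ext rfl (Prod.ext ?_ ?_)) <;> simp only <;> field_simp <;> ring
      simp only at hat
      rw [hback] at hat
      filter_upwards [hat.eventually (Φ.open_source.mem_nhds hys)] with w hw hcl
      have e1 : (w.1 + ε * ((2 * w.2.1 - w.1) / ε)) / 2 = w.2.1 := by field_simp; ring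
      have e2 : (w.1 + ε * ((2 * w.2.2 - w.1) / ε)) / 2 = w.2.2 := by field_simp; ring
      have hwv : closingMap q p r (ε, w.1, (2 * w.2.1 - w.1) / ε, (2 * w.2.2 - w.1) / ε) =
          (ε, 0, 0, 0) := by
        rw [closingMap_eq_iff hε0, e1, e2]
        exact hcl
      have heq := Φ.injOn hw hys (hwv.trans hyv.symm)
      rw [← heq]
      simp only [e1, e2]

/-! ### Zeros of the Melnikov function -/

theorem hasDerivAt_melnikov (q p r h : ℝ) :
    HasDerivAt (melnikov q p r)
      (r + 2 * p * (h * (Real.pi - 2 * Real.arctan h) - 1) +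
        2 * q * (h * (Real.pi - Real.arctan (h / 2)) - 1)) h := by
  have hA := (Real.hasDerivAt_arctan h).const_mul 2 |>.const_sub Real.pi
  have hB := ((hasDerivAt_id h).div_const 2).arctan.const_sub Real.pi
  have h2 := (hasDerivAt_id h).pow 2
  have := (((hasDerivAt_id h).const_mul r).add (((h2.const_add 1).const_mul p).mul hA)).add
    (((h2.const_add 4).const_mul q).mul hB)
  refine this.congr_deriv ?_
  have e1 : 1 + h ^ 2 ≠ 0 := by positivity
  have e2 : 4 + h ^ 2 ≠ 0 := by positivity
  have e3 : (1 + (h / 2) ^ 2) = (4 + h ^ 2) / 4 := by ring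
  simp only [id, Pi.pow_apply, e3]
  field_simp
  ring

theorem hasDerivAt_deriv_melnikov (q p r h : ℝ) :
    HasDerivAt (fun h => r + 2 * p * (h * (Real.pi - 2 * Real.arctan h) - 1) +
        2 * q * (h * (Real.pi - Real.arctan (h / 2)) - 1))
      (2 * p * (Real.pi - 2 * Real.arctan h - 2 * (h / (1 + h ^ 2))) +
        2 * q * (Real.pi - Real.arctan (h / 2) - 2 * (h / (4 + h ^ 2)))) h := by
  have hA := (Real.hasDerivAt_arctan h).const_mul 2 |>.const_sub Real.pi
  have hB := ((hasDerivAt_id h).div_const 2).arctan.const_sub Real.pi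
  have := (((((hasDerivAt_id h).mul hA).sub_const 1).const_mul (2 * p)).const_add r).add
    ((((hasDerivAt_id h).mul hB).sub_const 1).const_mul (2 * q))
  refine this.congr_deriv ?_
  have e1 : 1 + h ^ 2 ≠ 0 := by positivity
  have e2 : 4 + h ^ 2 ≠ 0 := by positivity
  have e3 : (1 + (h / 2) ^ 2) = (4 + h ^ 2) / 4 := by ring
  simp only [id, e3]
  field_simp
  ring

/-- The third derivative of the Melnikov function is
`-8 p / (1 + h²)² - 32 q / (4 + h²)²`, which is positive since `-p > 4 q`. -/
theorem strictMono_deriv_deriv_melnikov {q p : ℝ} (hq : 0 < q) (hp : 4 * q < -p) :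
    StrictMono fun h => 2 * p * (Real.pi - 2 * Real.arctan h - 2 * (h / (1 + h ^ 2))) +
        2 * q * (Real.pi - Real.arctan (h / 2) - 2 * (h / (4 + h ^ 2))) := by
  refine strictMono_of_deriv_pos fun h => ?_
  have e1 : 0 < 1 + h ^ 2 := by positivity
  have e2 : 0 < 4 + h ^ 2 := by positivity
  have e3 : (1 + (h / 2) ^ 2) = (4 + h ^ 2) / 4 := by ring
  have hA := (Real.hasDerivAt_arctan h).const_mul 2 |>.const_sub Real.pi
  have hB := ((hasDerivAt_id h).div_const 2).arctan.const_sub Real.pi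
  have hC := ((hasDerivAt_id h).div (((hasDerivAt_id h).pow 2).const_add 1) e1.ne').const_mul 2
  have hD := ((hasDerivAt_id h).div (((hasDerivAt_id h).pow 2).const_add 4) e2.ne').const_mul 2
  have hd := ((hA.sub hC).const_mul (2 * p)).add ((hB.sub hD).const_mul (2 * q))
  have hval : HasDerivAt (fun h => 2 * p * (Real.pi - 2 * Real.arctan h - 2 * (h / (1 + h ^ 2))) +
        2 * q * (Real.pi - Real.arctan (h / 2) - 2 * (h / (4 + h ^ 2))))
      (-8 * p / (1 + h ^ 2) ^ 2 - 32 * q / (4 + h ^ 2) ^ 2) h := by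
    refine hd.congr_deriv ?_
    simp only [id, Pi.pow_apply, e3]
    field_simp
    ring
  rw [hval.deriv, sub_pos]
  calc 32 * q / (4 + h ^ 2) ^ 2 < -8 * p / (4 + h ^ 2) ^ 2 :=
      div_lt_div_of_pos_right (by linarith) (by positivity)
    _ ≤ -8 * p / (1 + h ^ 2) ^ 2 := by
      have : 0 ≤ -8 * p := by linarith
      gcongr
      norm_num

/-- If `f''` is strictly monotone, then `f` has no multiple zero besides two other zeros. -/
theorem deriv_ne_zero_of_three_zeros {f f₁ f₂ : ℝ → ℝ} (h1 : ∀ x, HasDerivAt f (f₁ x) x)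
    (h2 : ∀ x, HasDerivAt f₁ (f₂ x) x) (h3 : StrictMono f₂) {x y z : ℝ} (hxy : x < y) (hyz : y < z)
    (hx : f x = 0) (hy : f y = 0) (hz : f z = 0) : f₁ x ≠ 0 ∧ f₁ y ≠ 0 ∧ f₁ z ≠ 0 := by
  have rolle : ∀ {g g' : ℝ → ℝ}, (∀ x, HasDerivAt g (g' x) x) → ∀ {a b : ℝ}, a < b → g a = 0 →
      g b = 0 → ∃ c ∈ Ioo a b, g' c = 0 := fun {g g'} hg {a b} hab ha hb =>
    exists_hasDerivAt_eq_zero hab (fun x _ => (hg x).continuousAt.continuousWithinAt)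
      (ha.trans hb.symm) fun x _ => hg x
  have key : ∀ {u v w : ℝ}, u < v → v < w → f₁ u = 0 → f₁ v = 0 → f₁ w = 0 → False := by
    intro u v w huv hvw hu hv hw
    obtain ⟨c, hc, hc0⟩ := rolle h2 huv hu hv
    obtain ⟨d, hd, hd0⟩ := rolle h2 hvw hv hw
    have := h3 (hc.2.trans hd.1)
    linarith
  obtain ⟨c, hc, hc0⟩ := rolle h1 hxy hx hy
  obtain ⟨d, hd, hd0⟩ := rolle h1 hyz hy hz
  exact ⟨fun h => key hc.1 (hc.2.trans hd.1) h hc0 hd0, fun h => key hc.2 hd.1 hc0 h hd0,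
    fun h => key (hc.2.trans hd.1) hd.2 hc0 hd0 h⟩

theorem arctan_le_self {x : ℝ} (hx : 0 ≤ x) : Real.arctan x ≤ x := by
  have := Real.le_tan (Real.arctan_nonneg.2 hx) (Real.arctan_lt_pi_div_two x)
  rwa [Real.tan_arctan] at this

theorem le_arctan_of_sqrt_le {x y : ℝ} (hx : 0 ≤ x) (hy : 0 < y) (h : 1 + x ^ 2 ≤ y ^ 2) :
    x / y ≤ Real.arctan x := by
  have h1 := Real.sin_le (Real.arctan_nonneg.2 hx)
  rw [Real.sin_arctan] at h1
  refine le_trans ?_ h1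
  have : √(1 + x ^ 2) ≤ y := Real.sqrt_le_iff.2 ⟨hy.le, h⟩
  have hs : 0 < √(1 + x ^ 2) := Real.sqrt_pos.2 (by positivity)
  gcongr

/-- For these coefficients the Melnikov function has three simple positive zeros: it changes sign
between `0`, `1 / 4`, `1` and `10`. -/
theorem exists_three_zeros_melnikov :
    ∃ h : Fin 3 → ℝ, (∀ i, 0 < h i) ∧ Function.Injective h ∧
      ∀ i, melnikov 5 (-21) (-5) (h i) = 0 ∧
        ∃ μ ≠ 0, HasDerivAt (melnikov 5 (-21) (-5)) μ (h i) := by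
  have hc : Continuous (melnikov 5 (-21) (-5)) :=
    continuous_iff_continuousAt.2 fun h => (hasDerivAt_melnikov 5 (-21) (-5) h).continuousAt
  have hpi1 := Real.pi_gt_d2
  have hpi2 := Real.pi_lt_d2
  have v0 : melnikov 5 (-21) (-5) 0 < 0 := by
    simp only [melnikov, zero_div, Real.arctan_zero]
    linarith
  have v1 : 0 < melnikov 5 (-21) (-5) (1 / 4) := by
    have hA := le_arctan_of_sqrt_le (x := 1 / 4) (y := 26 / 25) (by norm_num) (by norm_num)
      (by norm_num)
    have hB := arctan_le_self (x := 1 / 4 / 2) (by norm_num)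
    simp only [melnikov]
    linarith
  have v2 : melnikov 5 (-21) (-5) 1 < 0 := by
    have hB := le_arctan_of_sqrt_le (x := 1 / 2) (y := 9 / 8) (by norm_num) (by norm_num)
      (by norm_num)
    simp only [melnikov, Real.arctan_one]
    linarith
  have v3 : 0 < melnikov 5 (-21) (-5) 10 := by
    have hA := arctan_le_self (x := 10⁻¹) (by norm_num)
    rw [Real.arctan_inv_of_pos (by norm_num)] at hA
    have hB := Real.arctan_lt_pi_div_two (10 / 2)
    simp only [melnikov]
    linarith
  obtain ⟨z₁, hz₁, e₁⟩ := intermediate_value_Ioo (by norm_num) hc.continuousOn ⟨v0, v1⟩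
  obtain ⟨z₂, hz₂, e₂⟩ := intermediate_value_Ioo' (by norm_num) hc.continuousOn ⟨v2, v1⟩
  obtain ⟨z₃, hz₃, e₃⟩ := intermediate_value_Ioo (by norm_num) hc.continuousOn ⟨v2, v3⟩
  have h12 : z₁ < z₂ := hz₁.2.trans hz₂.1
  have h23 : z₂ < z₃ := hz₂.2.trans hz₃.1
  have hz₁0 : 0 < z₁ := hz₁.1
  obtain ⟨d₁, d₂, d₃⟩ := deriv_ne_zero_of_three_zeros (hasDerivAt_melnikov 5 (-21) (-5))
    (hasDerivAt_deriv_melnikov 5 (-21) (-5))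
    (strictMono_deriv_deriv_melnikov (by norm_num) (by norm_num)) h12 h23 e₁ e₂ e₃
  have hd := hasDerivAt_melnikov 5 (-21) (-5)
  refine ⟨![z₁, z₂, z₃], ?_, ?_, ?_⟩
  · intro i
    fin_cases i
    · exact hz₁0
    · exact hz₁0.trans h12
    · exact hz₁0.trans (h12.trans h23)
  · refine StrictMono.injective (Fin.strictMono_iff_lt_succ.2 fun i => ?_)
    fin_cases i
    · exact h12
    · exact h23
  · intro i
    fin_cases i
    · exact ⟨e₁, _, d₁, hd z₁⟩
    · exact ⟨e₂, _, d₂, hd z₂⟩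
    · exact ⟨e₃, _, d₃, hd z₃⟩

/-! ### Continuity of loops in the parameters -/

theorem eventually_dist_lt_of_continuous {Q : Type*} [TopologicalSpace Q] {F : Q → ℝ → ℝ × ℝ}
    (hF : Continuous fun z : Q × ℝ => F z.1 z.2) (q₀ : Q) {η : ℝ} (hη : 0 < η) :
    ∀ᶠ q in 𝓝 q₀, ∀ u ∈ Icc (0 : ℝ) 1, dist (F q u) (F q₀ u) < η := by
  refine isCompact_Icc.eventually_forall_of_forall_eventually fun u _ => ?_
  have hc : Continuous fun z : Q × ℝ => dist (F z.1 z.2) (F q₀ z.2) :=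
    hF.dist (hF.comp (continuous_const.prodMk continuous_snd))
  refine hc.continuousAt.eventually (gt_mem_nhds ?_)
  simpa using hη

/-- Arcs that depend continuously on parameters, including their duration, depend continuously on
them in the Hausdorff sense. -/
theorem eventually_image_subset_thickening {Q : Type*} [TopologicalSpace Q] {F : Q → ℝ → ℝ × ℝ}
    {τ : Q → ℝ} (hF : Continuous fun z : Q × ℝ => F z.1 z.2) (hτ : Continuous τ) (q₀ : Q) {η : ℝ}
    (hη : 0 < η) (h0 : 0 ≤ τ q₀) : ∀ᶠ q in 𝓝 q₀, 0 ≤ τ q →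
      F q '' Icc 0 (τ q) ⊆ Metric.thickening η (F q₀ '' Icc 0 (τ q₀)) ∧
      F q₀ '' Icc 0 (τ q₀) ⊆ Metric.thickening η (F q '' Icc 0 (τ q)) := by
  have hG : Continuous fun z : Q × ℝ => F z.1 (τ z.1 * z.2) :=
    hF.comp (continuous_fst.prodMk ((hτ.comp continuous_fst).mul continuous_snd))
  have himg : ∀ q, 0 ≤ τ q → F q '' Icc 0 (τ q) = (fun u => F q (τ q * u)) '' Icc 0 1 :=
    fun q hq => by
      rw [← image_image (F q) (fun u => τ q * u), image_mul_left_Icc hq zero_le_one, mul_zero,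
        mul_one]
  filter_upwards [eventually_dist_lt_of_continuous (F := fun q u => F q (τ q * u)) hG q₀ hη]
    with q hq hτq
  rw [himg q hτq, himg q₀ h0]
  constructor
  · rintro _ ⟨u, hu, rfl⟩
    exact Metric.mem_thickening_iff.2 ⟨_, ⟨u, hu, rfl⟩, hq u hu⟩
  · rintro _ ⟨u, hu, rfl⟩
    exact Metric.mem_thickening_iff.2 ⟨_, ⟨u, hu, rfl⟩, by rw [dist_comm]; exact hq u hu⟩

/-- Loops depend continuously on their data. The components of `q` are, in this order, the
arguments `k`, `m`, `s`, `a`, `c` and `d` of `loopSet`. -/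
theorem eventually_loopSet_subset_thickening (q₀ : ℝ × ℝ × ℝ × ℝ × ℝ × ℝ)
    (h₀ : 0 ≤ q₀.2.2.2.1 + q₀.2.2.1) {η : ℝ} (hη : 0 < η) :
    ∀ᶠ q in 𝓝 q₀, 0 ≤ q.2.2.2.1 + q.2.2.1 →
      loopSet q.1 q.2.1 q.2.2.1 q.2.2.2.1 q.2.2.2.2.1 q.2.2.2.2.2 ⊆ Metric.thickening η
        (loopSet q₀.1 q₀.2.1 q₀.2.2.1 q₀.2.2.2.1 q₀.2.2.2.2.1 q₀.2.2.2.2.2) ∧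
      loopSet q₀.1 q₀.2.1 q₀.2.2.1 q₀.2.2.2.1 q₀.2.2.2.2.1 q₀.2.2.2.2.2 ⊆ Metric.thickening η
        (loopSet q.1 q.2.1 q.2.2.1 q.2.2.2.1 q.2.2.2.2.1 q.2.2.2.2.2) := by
  have harc := Real.continuous_arctan
  have e1 := eventually_image_subset_thickening (Q := ℝ × ℝ × ℝ × ℝ × ℝ × ℝ)
    (F := fun q => arcR q.2.2.1 q.2.2.2.1) (τ := fun q => 2 * Real.arctan (q.2.2.2.1 + q.2.2.1))
    (by unfold arcR spiral; fun_prop) (by fun_prop) q₀ hη (by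
      have := Real.arctan_nonneg.2 h₀
      simpa using this)
  have e2 := eventually_image_subset_thickening (Q := ℝ × ℝ × ℝ × ℝ × ℝ × ℝ)
    (F := fun q => spiral q.2.1 (1, -(q.2.2.2.1 + 2 * q.2.2.1)))
    (τ := fun q => Real.pi - Real.arctan (q.2.2.2.1 + 2 * q.2.2.1) - Real.arctan (2 * q.2.2.2.2.1))
    (by unfold spiral; fun_prop) (by fun_prop) q₀ hη
    (by linarith [arctan_add_arctan_lt_pi (q₀.2.2.2.1 + 2 * q₀.2.2.1) (2 * q₀.2.2.2.2.1)])
  have e3 := eventually_image_subset_thickening (Q := ℝ × ℝ × ℝ × ℝ × ℝ × ℝ)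
    (F := fun q => arcL q.1 q.2.2.2.2.1)
    (τ := fun q => 2 * Real.pi - Real.arctan q.2.2.2.2.1 - Real.arctan q.2.2.2.2.2)
    (by unfold arcL leftChart spiral; fun_prop) (by fun_prop) q₀ hη
    (by linarith [arctan_add_arctan_lt_pi (q₀.2.2.2.2.1) (q₀.2.2.2.2.2), Real.pi_pos])
  have e4 := eventually_image_subset_thickening (Q := ℝ × ℝ × ℝ × ℝ × ℝ × ℝ)
    (F := fun q => spiral q.2.1 (-1, 2 * q.2.2.2.2.2))
    (τ := fun q => Real.pi - Real.arctan (2 * q.2.2.2.2.2) - Real.arctan q.2.2.2.1)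
    (by unfold spiral; fun_prop) (by fun_prop) q₀ hη
    (by linarith [arctan_add_arctan_lt_pi (2 * q₀.2.2.2.2.2) (q₀.2.2.2.1)])
  filter_upwards [e1, e2, e3, e4] with q h1 h2 h3 h4 hq
  replace h1 := h1 (by have := Real.arctan_nonneg.2 hq; simpa using this)
  replace h2 := h2 (by
    linarith [arctan_add_arctan_lt_pi (q.2.2.2.1 + 2 * q.2.2.1) (2 * q.2.2.2.2.1)])
  replace h3 := h3 (by linarith [arctan_add_arctan_lt_pi (q.2.2.2.2.1) (q.2.2.2.2.2),
    Real.pi_pos])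
  replace h4 := h4 (by linarith [arctan_add_arctan_lt_pi (2 * q.2.2.2.2.2) (q.2.2.2.1)])
  simp only [loopSet, Metric.thickening_union]
  exact ⟨union_subset_union (union_subset_union (union_subset_union h1.1 h2.1) h3.1) h4.1,
    union_subset_union (union_subset_union (union_subset_union h1.2 h2.2) h3.2) h4.2⟩

/-! ### The unperturbed system -/

theorem isTurn_zero (θ y : ℝ) : IsTurn θ 0 y y := by simp [IsTurn]

theorem isLoop_unperturbed {h : ℝ} (hh : 0 < h) : IsLoop 0 0 0 h (h / 2) (h / 2) := by
  have e : 2 * (h / 2) = h := by ring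
  constructor <;> simp only [abs_zero, mul_zero, add_zero, e, isTurn_zero] <;> positivity

theorem exists_polar {u w ρ : ℝ} (hρ : 0 ≤ ρ) (h : u ^ 2 + w ^ 2 = ρ ^ 2) :
    ∃ θ, |θ| ≤ Real.pi ∧ u = ρ * Real.cos θ ∧ w = ρ * Real.sin θ := by
  have hn : ‖(⟨u, w⟩ : ℂ)‖ = ρ := by
    rw [← sq_eq_sq₀ (norm_nonneg _) hρ, ← h, ← Complex.normSq_eq_norm_sq, Complex.normSq_mk]
    ring
  refine ⟨Complex.arg ⟨u, w⟩, Complex.abs_arg_le_pi _, ?_, ?_⟩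
  · rw [← hn, Complex.norm_mul_cos_arg]
  · rw [← hn, Complex.norm_mul_sin_arg]

theorem abs_le_of_cos_le {x y : ℝ} (hy : 0 ≤ y) (hx : |x| ≤ Real.pi)
    (h : Real.cos y ≤ Real.cos x) : |x| ≤ y := by
  by_contra! hlt
  have := Real.cos_lt_cos_of_nonneg_of_le_pi hy hx hlt
  rw [Real.cos_abs] at this
  linarith

theorem spiral_zero_sq_add_sq (p : ℝ × ℝ) (t : ℝ) :
    (spiral 0 p t).1 ^ 2 + (spiral 0 p t).2 ^ 2 = p.1 ^ 2 + p.2 ^ 2 := by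
  simp only [spiral, zero_mul, Real.exp_zero, one_mul]
  linear_combination (p.1 ^ 2 + p.2 ^ 2) * Real.sin_sq_add_cos_sq t

/-- Points of a circle as points of an orbit. -/
theorem eq_spiral_of_polar {X β φ u w : ℝ} (hu : u = X * √(1 + β ^ 2) * Real.cos φ)
    (hw : w = -(X * √(1 + β ^ 2) * Real.sin φ)) :
    spiral 0 (X, -(X * β)) (φ - Real.arctan β) = (u, w) := by
  rw [spiral_polar, hu, hw]
  simp

theorem cos_arctan_mul_sqrt (β : ℝ) : √(1 + β ^ 2) * Real.cos (Real.arctan β) = 1 := by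
  have hs : √(1 + β ^ 2) ≠ 0 := (Real.sqrt_pos.2 (by positivity)).ne'
  rw [Real.cos_arctan]
  field_simp

theorem IsZoneArc.image_subset {X : PWZone → ℝ × ℝ → ℝ × ℝ} {z : PWZone} {p q : ℝ × ℝ}
    {T : ℝ} {σ : ℝ → ℝ × ℝ} (h : IsZoneArc X z p q T σ) :
    σ '' Icc 0 T ⊆ insert p (insert q z.region) := fun x hx => by
  by_cases hz : x ∈ z.region
  · exact .inr (.inr hz)
  · exact (h.eq_or_eq_of_not_mem_region hx hz).imp id .inl

theorem image_arcR_unperturbed {h : ℝ} (hh : 0 < h) :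
    arcR 0 h '' Icc 0 (2 * Real.arctan (h + 0)) =
      {p | 1 ≤ p.1 ∧ p.1 ^ 2 + p.2 ^ 2 = 1 + h ^ 2} := by
  have ha : 0 < Real.arctan h := Real.arctan_pos.2 hh
  ext p
  constructor
  · intro hp
    constructor
    · rcases (isZoneArc_arcR 0 0 (s := 0) (by linarith)).image_subset hp with rfl | rfl | hp
      · exact le_rfl
      · exact le_rfl
      · exact le_of_lt hp
    · obtain ⟨t, -, rfl⟩ := hp
      have := spiral_zero_sq_add_sq (1, 1 * (h + 0)) t
      simp only [arcR]
      linear_combination this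
  · rintro ⟨h1, h2⟩
    have hs : 0 < √(1 + h ^ 2) := Real.sqrt_pos.2 (by positivity)
    obtain ⟨θ, hθ, e1, e2⟩ := exists_polar (u := p.1) (w := -p.2) hs.le
      (by rw [Real.sq_sqrt (by positivity)]; linear_combination h2)
    have hc : Real.cos (Real.arctan h) ≤ Real.cos θ := by
      rw [← mul_le_mul_iff_of_pos_left hs, cos_arctan_mul_sqrt, ← e1]
      exact h1
    have hle := abs_le.1 (abs_le_of_cos_le ha.le hθ hc)
    refine ⟨θ + Real.arctan h, ⟨by linarith [hle.1], by rw [add_zero]; linarith [hle.2]⟩, ?_⟩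
    have := eq_spiral_of_polar (X := 1) (β := -h) (φ := θ) (u := p.1) (w := p.2)
      (by rw [neg_sq, one_mul]; exact e1) (by rw [neg_sq, one_mul]; linarith)
    rw [Real.arctan_neg, sub_neg_eq_add, show -(1 * -h) = 1 * (h + 0) by ring] at this
    rw [arcR, this, sub_zero]

theorem image_lower_unperturbed {h : ℝ} (hh : 0 < h) :
    spiral 0 (1, -h) '' Icc 0 (Real.pi - Real.arctan h - Real.arctan h) =
      {p | -1 ≤ p.1 ∧ p.1 ≤ 1 ∧ p.2 < 0 ∧ p.1 ^ 2 + p.2 ^ 2 = 1 + h ^ 2} := by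
  have ha : 0 < Real.arctan h := Real.arctan_pos.2 hh
  have hb := Real.arctan_lt_pi_div_two h
  have hs : 0 < √(1 + h ^ 2) := Real.sqrt_pos.2 (by positivity)
  ext p
  constructor
  · intro hp
    have hx : -1 ≤ p.1 ∧ p.1 ≤ 1 := by
      rcases (isZoneArc_lower 0 0 (m := 0) (by simpa using hh) (by simpa using hh)
        (isTurn_zero _ h)).image_subset hp with rfl | rfl | hp
      · norm_num
      · norm_num
      · exact ⟨hp.1.le, hp.2.le⟩
    obtain ⟨t, ht, rfl⟩ := hp
    refine ⟨hx.1, hx.2, ?_, ?_⟩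
    · have := spiral_polar 0 1 h t
      rw [one_mul] at this
      rw [this]
      have hsin : 0 < Real.sin (t + Real.arctan h) :=
        Real.sin_pos_of_pos_of_lt_pi (by linarith [ht.1]) (by linarith [ht.2])
      simp only [zero_mul, Real.exp_zero, one_mul, Left.neg_neg_iff]
      exact mul_pos hs hsin
    · rw [spiral_zero_sq_add_sq]
      ring
  · rintro ⟨h1, h2, h3, h4⟩
    obtain ⟨θ, hθ, e1, e2⟩ := exists_polar (u := p.1) (w := -p.2) hs.le
      (by rw [Real.sq_sqrt (by positivity)]; linear_combination h4)
    have hθ0 : 0 < θ := by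
      by_contra! hneg
      have := Real.sin_nonpos_of_nonpos_of_neg_pi_le hneg (abs_le.1 hθ).1
      have := mul_nonpos_of_nonneg_of_nonpos hs.le this
      linarith
    rw [abs_of_pos hθ0] at hθ
    have hlo : Real.arctan h ≤ θ := by
      by_contra! hlt
      have := Real.cos_lt_cos_of_nonneg_of_le_pi hθ0.le (by linarith) hlt
      rw [← mul_lt_mul_iff_of_pos_left hs, cos_arctan_mul_sqrt, ← e1] at this
      linarith
    have hhi : θ ≤ Real.pi - Real.arctan h := by
      by_contra! hlt
      have := Real.cos_lt_cos_of_nonneg_of_le_pi (by linarith) hθ hlt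
      rw [Real.cos_pi_sub, ← mul_lt_mul_iff_of_pos_left hs, mul_neg, cos_arctan_mul_sqrt,
        ← e1] at this
      linarith
    refine ⟨θ - Real.arctan h, ⟨by linarith, by linarith⟩, ?_⟩
    have := eq_spiral_of_polar (X := 1) (β := h) (φ := θ) (u := p.1) (w := p.2)
      (by rw [one_mul]; exact e1) (by rw [one_mul]; linarith)
    rw [one_mul] at this
    exact this

theorem image_upper_unperturbed {h : ℝ} (hh : 0 < h) :
    spiral 0 (-1, h) '' Icc 0 (Real.pi - Real.arctan h - Real.arctan h) =
      {p | -1 ≤ p.1 ∧ p.1 ≤ 1 ∧ 0 < p.2 ∧ p.1 ^ 2 + p.2 ^ 2 = 1 + h ^ 2} := by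
  have hneg : spiral 0 (-1, h) = fun t => -spiral 0 (1, -h) t := by
    ext1 t
    rw [← spiral_neg]
    simp
  rw [hneg, ← image_image (fun p : ℝ × ℝ => -p), image_lower_unperturbed hh]
  ext p
  simp only [mem_image, mem_ofPred_eq]
  constructor
  · rintro ⟨q, ⟨h1, h2, h3, h4⟩, rfl⟩
    simp only [Prod.fst_neg, Prod.snd_neg, neg_sq]
    exact ⟨by linarith, by linarith, by linarith, h4⟩
  · rintro ⟨h1, h2, h3, h4⟩
    refine ⟨-p, ?_, neg_neg p⟩
    simp only [Prod.fst_neg, Prod.snd_neg, neg_sq]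
    exact ⟨by linarith, by linarith, by linarith, h4⟩

theorem image_arcL_unperturbed {c : ℝ} (hc : 0 < c) :
    arcL 0 c '' Icc 0 (2 * Real.pi - Real.arctan c - Real.arctan c) =
      {p | p.1 ≤ -1 ∧ (p.1 + 5) ^ 2 + (p.1 + 2 * p.2 + 1) ^ 2 = 16 + 16 * c ^ 2} := by
  have ha : 0 < Real.arctan c := Real.arctan_pos.2 hc
  have hb := Real.arctan_lt_pi_div_two c
  have hs : 0 < √(1 + c ^ 2) := Real.sqrt_pos.2 (by positivity)
  ext p
  constructor
  · intro hp
    constructor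
    · rcases (isZoneArc_arcL 0 0 (k := 0) (by simpa using hc) (by simpa using hc)
        (isTurn_zero _ c)).image_subset hp with rfl | rfl | hp
      · exact le_rfl
      · exact le_rfl
      · exact le_of_lt hp
    · obtain ⟨t, -, rfl⟩ := hp
      have := spiral_zero_sq_add_sq (4, -(4 * c)) t
      simp only [arcL, leftChart]
      linear_combination this
  · rintro ⟨h1, h2⟩
    obtain ⟨θ, hθ, e1, e2⟩ := exists_polar (u := -(p.1 + 5)) (w := p.1 + 2 * p.2 + 1)
      (ρ := 4 * √(1 + c ^ 2)) (by positivity)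
      (by rw [mul_pow, Real.sq_sqrt (by positivity)]; linear_combination h2)
    have hle : |θ| ≤ Real.pi - Real.arctan c := by
      refine abs_le_of_cos_le (by linarith [Real.pi_pos]) hθ ?_
      rw [Real.cos_pi_sub, ← mul_le_mul_iff_of_pos_left hs, mul_neg, cos_arctan_mul_sqrt]
      linarith
    rw [abs_le] at hle
    refine ⟨θ + Real.pi - Real.arctan c, ⟨by linarith [hle.1], by linarith [hle.2]⟩, ?_⟩
    have := eq_spiral_of_polar (X := 4) (β := c) (φ := θ + Real.pi) (u := p.1 + 5)
      (w := p.1 + 2 * p.2 + 1) (by rw [Real.cos_add_pi]; linarith)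
      (by rw [Real.sin_add_pi]; linarith)
    rw [arcL, this, leftChart]
    ext
    · simp only; ring
    · simp only; ring

/-- The Hamiltonians of the unperturbed system, with its centers at `(-5, 2)` and at the origin. -/
def centerHam : PWZone → QuadHam :=
  normalForm (aL := 1) (bL := 2) (cL := -1) (βL := -3) (aR := 0) (bR := 1) (cR := -1) (βR := 0)

/-- The closed curves `L_h` are the loops of the unperturbed system. -/
theorem annulusOrbit_eq_loopSet {h : ℝ} (hh : 0 < h) :
    annulusOrbit centerHam h = loopSet 0 0 0 h (h / 2) (h / 2) := by
  have e : 2 * (h / 2) = h := by ring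
  have hh2 : 0 < h / 2 := by positivity
  simp only [loopSet, e, mul_zero, add_zero h]
  have hR := image_arcR_unperturbed hh
  rw [add_zero] at hR
  rw [hR, image_lower_unperturbed hh, image_arcL_unperturbed hh2, image_upper_unperturbed hh]
  ext ⟨x, y⟩
  simp only [annulusOrbit, centerHam, normalForm, QuadHam.eval, mem_union, mem_ofPred_eq]
  constructor
  · rintro (((⟨h1, h2⟩ | ⟨h1, h2, h3, h4⟩) | ⟨h1, h2⟩) | ⟨h1, h2, h3, h4⟩)
    · exact .inl (.inl (.inl ⟨h1.le, by linarith⟩))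
    · exact .inl (.inl (.inr ⟨h1, h2, h3, by linarith⟩))
    · exact .inl (.inr ⟨h1.le, by linarith⟩)
    · exact .inr ⟨h1, h2, h3, by linarith⟩
  · rintro (((⟨h1, h2⟩ | ⟨h1, h2, h3, h4⟩) | ⟨h1, h2⟩) | ⟨h1, h2, h3, h4⟩)
    · rcases h1.eq_or_lt with rfl | h1
      · rcases lt_trichotomy y 0 with hy | rfl | hy
        · exact .inl (.inl (.inr ⟨by norm_num, le_rfl, hy, by linarith⟩))
        · nlinarith
        · exact .inr ⟨by norm_num, le_rfl, hy, by linarith⟩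
      · exact .inl (.inl (.inl ⟨h1, by linarith⟩))
    · exact .inl (.inl (.inr ⟨h1, h2, h3, by linarith⟩))
    · rcases h1.eq_or_lt with rfl | h1
      · rcases lt_trichotomy y 0 with hy | rfl | hy
        · exact .inl (.inl (.inr ⟨le_rfl, by norm_num, hy, by linarith⟩))
        · nlinarith
        · exact .inr ⟨le_rfl, by norm_num, hy, by linarith⟩
      · exact .inl (.inr ⟨h1, by linarith⟩)
    · exact .inr ⟨h1, h2, h3, by linarith⟩

theorem spiral_zero_periodic (p : ℝ × ℝ) :
    Function.Periodic (spiral 0 p) (2 * Real.pi) := fun t => by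
  simp [spiral]

theorem spiral_zero_pi (p : ℝ × ℝ) : spiral 0 p Real.pi = -p := by
  ext <;> simp [spiral]

theorem isCenterAt_left : IsCenterAt (focusField 0 0 0 .L) (-5, 2) := by
  refine ⟨by ext <;> norm_num [focusField], univ, isOpen_univ, mem_univ _, fun q _ hq => ?_⟩
  set p : ℝ × ℝ := (q.1 + 5, q.1 + 2 * q.2 + 1) with hp
  refine ⟨fun t => leftChart (spiral 0 p t), 2 * Real.pi,
    fun t => hasDerivAt_leftChart_spiral 0 0 0 p t, ?_, by positivity,
    fun t => by simp only [spiral_zero_periodic p t], Real.pi, fun h => hq ?_⟩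
  · simp only [spiral_zero]
    ext
    · simp only [leftChart, hp]; ring
    · simp only [leftChart, hp]; ring
  · simp only [spiral_zero, spiral_zero_pi] at h
    have h1 := congrArg Prod.fst h
    have h2 := congrArg Prod.snd h
    simp only [leftChart, hp, Prod.fst_neg, Prod.snd_neg] at h1 h2
    ext
    · simp only; linarith
    · simp only; linarith

theorem isCenterAt_origin {Y : ℝ × ℝ → ℝ × ℝ} (hY : ∀ p, Y p = (p.2, -p.1)) : IsCenterAt Y 0 := by
  refine ⟨by simp [hY], univ, isOpen_univ, mem_univ _, fun q _ hq => ?_⟩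
  refine ⟨spiral 0 q, 2 * Real.pi, fun t => ?_, spiral_zero _ _, by positivity,
    spiral_zero_periodic q, Real.pi, fun h => hq ?_⟩
  · refine (hasDerivAt_spiral 0 0 0 q t).congr_deriv ?_
    simp [focusField, hY]
  · rw [spiral_zero, spiral_zero_pi] at h
    exact neg_eq_self.1 h

/-- The perturbation that realizes the focus fields with expansion rates `ε q` and `ε p` and with
the shift `ε r`. -/
def focusPert (q p r : ℝ) : PWZone → AffPert
  | .L => { p := q, q := 0, r := 5 * q, s := 0, u := q, v := -2 * q }
  | .C => { p := p, q := 0, r := 0, s := 0, u := p, v := 0 }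
  | .R => { p := 0, q := 0, r := r, s := 0, u := 0, v := 0 }

theorem nearHamField_focusPert (q p r ε : ℝ) :
    nearHamField centerHam (focusPert q p r) ε = focusField (ε * q) (ε * p) (ε * r) := by
  ext1 z
  ext1 x
  rw [nearHamField_eq]
  cases z <;> ext <;> simp only [centerHam, normalForm, focusPert, focusField] <;> ring

theorem nearHamField_zero (P : PWZone → AffPert) :
    nearHamField centerHam P 0 = focusField 0 0 0 := by
  ext1 z
  ext1 x
  rw [nearHamField_eq]
  cases z <;> ext <;> simp only [centerHam, normalForm, focusField] <;> ring

/-! ### Bifurcation of limit cycles -/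

/-- A simple zero of the Melnikov function yields, for all small `ε > 0`, a loop that is a limit
cycle and that is close to the corresponding unperturbed orbit. -/
theorem exists_limitCycle_branch {q p r h μ : ℝ} (hq : q ≠ 0) (hp : p ≠ 0) (hh : 0 < h) (hμ : μ ≠ 0)
    (h0 : melnikov q p r h = 0) (hd : HasDerivAt (melnikov q p r) μ h) :
    ∃ x : ℝ → ℝ × ℝ × ℝ, Tendsto (fun ε => (x ε).1) (𝓝[>] 0) (𝓝 h) ∧
      (∀ᶠ ε in 𝓝[>] 0, IsLoop (ε * q) (ε * p) (ε * r) (x ε).1 (x ε).2.1 (x ε).2.2 ∧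
        IsCrossingLimitCycle (focusField (ε * q) (ε * p) (ε * r))
          (loopSet (ε * q) (ε * p) (ε * r) (x ε).1 (x ε).2.1 (x ε).2.2)) ∧
      ∀ η > 0, ∀ᶠ ε in 𝓝[>] 0,
        loopSet (ε * q) (ε * p) (ε * r) (x ε).1 (x ε).2.1 (x ε).2.2 ⊆
          Metric.thickening η (annulusOrbit centerHam h) ∧
        annulusOrbit centerHam h ⊆ Metric.thickening η
          (loopSet (ε * q) (ε * p) (ε * r) (x ε).1 (x ε).2.1 (x ε).2.2) := by
  obtain ⟨x, hx, hcl⟩ := exists_branch hh.ne' hμ h0 hd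
  have hε : Tendsto (fun ε : ℝ => ε) (𝓝[>] 0) (𝓝 0) := tendsto_id.mono_left nhdsWithin_le_nhds
  have hscale : ∀ v : ℝ, Tendsto (fun ε : ℝ => ε * v) (𝓝[>] 0) (𝓝 0) := fun v => by
    simpa using hε.mul_const v
  have ha : Tendsto (fun ε => (x ε).1) (𝓝[>] 0) (𝓝 h) := (continuous_fst.tendsto _).comp hx
  have hc : Tendsto (fun ε => (x ε).2.1) (𝓝[>] 0) (𝓝 (h / 2)) :=
    (continuous_snd.fst.tendsto _).comp hx
  have hdd : Tendsto (fun ε => (x ε).2.2) (𝓝[>] 0) (𝓝 (h / 2)) :=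
    (continuous_snd.snd.tendsto _).comp hx
  have hdata := (hscale q).prodMk_nhds ((hscale p).prodMk_nhds ((hscale r).prodMk_nhds hx))
  have hloop : ∀ᶠ ε in 𝓝[>] 0,
      IsLoop (ε * q) (ε * p) (ε * r) (x ε).1 (x ε).2.1 (x ε).2.2 := by
    have lt : ∀ {f g : ℝ → ℝ} {u v : ℝ}, Tendsto f (𝓝[>] 0) (𝓝 u) → Tendsto g (𝓝[>] 0) (𝓝 v) →
        u < v → ∀ᶠ ε in 𝓝[>] 0, f ε < g ε := fun hf hg h => hf.eventually_lt hg h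
    have hm0 : Tendsto (fun ε => |ε * p|) (𝓝[>] 0) (𝓝 0) := by simpa using (hscale p).abs
    have hk0 : Tendsto (fun ε => |ε * q|) (𝓝[>] 0) (𝓝 0) := by simpa using (hscale q).abs
    have hz : Tendsto (fun _ : ℝ => (0 : ℝ)) (𝓝[>] 0) (𝓝 0) := tendsto_const_nhds
    filter_upwards [hcl, lt hz (ha.add (hscale r)) (by linarith), lt hm0 ha hh,
      lt hm0 (ha.add ((hscale r).const_mul 2)) (by linarith), lt hm0 (hc.const_mul 2) (by linarith),
      lt hm0 (hdd.const_mul 2) (by linarith), lt hk0 hc (by linarith), lt hk0 hdd (by linarith)]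
      with ε h1 i1 i2 i3 i4 i5 i6 i7
    exact ⟨i1, i2, i3, i4, i5, i6, i7, h1.1.1, h1.1.2.1, h1.1.2.2⟩
  refine ⟨x, ha, ?_, fun η hη => ?_⟩
  · filter_upwards [hloop, hcl, self_mem_nhdsWithin] with ε h1 h2 hpos
    have hε0 : ε ≠ 0 := (show (0 : ℝ) < ε from hpos).ne'
    refine ⟨h1, h1.isCrossingLimitCycle (mul_ne_zero hε0 hq) (mul_ne_zero hε0 hp) ?_⟩
    filter_upwards [h2.2] with y hy hl
    exact hy ⟨hl.lower, hl.left, hl.upper⟩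
  · rw [annulusOrbit_eq_loopSet hh]
    have := hdata.eventually (eventually_loopSet_subset_thickening
      (0, 0, 0, h, h / 2, h / 2) (by simpa using hh.le) hη)
    filter_upwards [this, hloop] with ε h1 h2
    exact h1 h2.pos_right.le

theorem IsLoop.eq_of_loopSet_eq {k m s a c d a' c' d' : ℝ} (h : IsLoop k m s a c d)
    (h' : IsLoop k m s a' c' d') (he : loopSet k m s a c d = loopSet k m s a' c' d') : a = a' := by
  have hmem : ((1 : ℝ), a) ∈ loopSet k m s a' c' d' := by
    rw [← he]
    refine .inl (.inl (.inl ⟨0, ⟨le_rfl, ?_⟩, (isZoneArc_arcR k m h.pos_right).source⟩))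
    exact (isZoneArc_arcR k m h.pos_right).pos.le
  have ha := (abs_nonneg m).trans_lt h.lt_a
  have hb := (abs_nonneg m).trans_lt h'.lt_b
  rcases h'.eq_corner hmem fun z hz => (PWZone.fst_ne_of_mem_region hz).2 rfl with h1 | h1 | h1 | h1
  · exact congrArg Prod.snd h1
  · have := congrArg Prod.snd h1
    simp only at this
    linarith
  · have := congrArg Prod.fst h1
    norm_num at this
  · have := congrArg Prod.fst h1
    norm_num at this

theorem mainTheorem11 (H : PWZone → QuadHam)
    (hH : H = normalForm (aL := 1) (bL := 2) (cL := -1) (βL := -3)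
      (aR := 0) (bR := 1) (cR := -1) (βR := 0)) :
    -- the unperturbed system: positions of the three centers, and the periodic annulus
    (∀ P : PWZone → AffPert,
      HasRealCenter (nearHamField H P 0) .L ∧
      HasRealCenter (nearHamField H P 0) .C ∧
      HasVirtualCenter (nearHamField H P 0) .R ∧
      ∀ h : ℝ, 0 < h →
        IsCrossingPeriodicOrbit (nearHamField H P 0) (annulusOrbit H h) ∧
        VisitsAllZones (annulusOrbit H h)) ∧
    -- for a suitable perturbation, three limit cycles bifurcate from three orbits of the annulus
    ∃ P : PWZone → AffPert, ∃ h : Fin 3 → ℝ,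
      (∀ i, 0 < h i) ∧ Function.Injective h ∧
      ∀ η : ℝ, 0 < η → ∃ ε₀ : ℝ, 0 < ε₀ ∧ ∀ ε : ℝ, 0 < ε → ε < ε₀ →
        ∃ Γ : Fin 3 → Set (ℝ × ℝ), Function.Injective Γ ∧
          ∀ i, IsCrossingLimitCycle (nearHamField H P ε) (Γ i) ∧
            VisitsAllZones (Γ i) ∧
            Γ i ⊆ Metric.thickening η (annulusOrbit H (h i)) ∧
            annulusOrbit H (h i) ⊆ Metric.thickening η (Γ i) := by
  obtain rfl : H = centerHam := hH
  refine ⟨fun P => ?_, focusPert 5 (-21) (-5), ?_⟩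
  · rw [nearHamField_zero]
    refine ⟨⟨_, isCenterAt_left, ?_⟩, ⟨0, isCenterAt_origin fun p => ?_, ?_⟩,
      ⟨0, isCenterAt_origin fun p => ?_, ?_⟩, fun h hh => ?_⟩
    · norm_num [PWZone.region]
    · simp [focusField]
    · norm_num [PWZone.region]
    · simp [focusField]
    · norm_num [PWZone.region]
    · rw [annulusOrbit_eq_loopSet hh]
      exact ⟨(isLoop_unperturbed hh).isCrossingPeriodicOrbit,
        (isLoop_unperturbed hh).visitsAllZones⟩
  · obtain ⟨h, hpos, hinj, hzero⟩ := exists_three_zeros_melnikov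
    refine ⟨h, hpos, hinj, fun η hη => ?_⟩
    choose hz μ hμ hd using hzero
    choose x hx hcyc hclose using fun i =>
      exists_limitCycle_branch (by norm_num) (by norm_num) (hpos i) (hμ i) (hz i) (hd i)
    have hne : ∀ᶠ ε in 𝓝[>] 0, ∀ i j, i ≠ j → (x i ε).1 ≠ (x j ε).1 := by
      simp only [eventually_all]
      exact fun i j hij => (((hx i).sub (hx j)).eventually_ne (sub_ne_zero.2 (hinj.ne hij))).mono
        fun ε h => sub_ne_zero.1 h
    have hall := (eventually_all.2 hcyc).and ((eventually_all.2 fun i => hclose i η hη).and hne)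
    obtain ⟨ε₀, hε₀, hsub⟩ := mem_nhdsGT_iff_exists_Ioo_subset.1 hall
    refine ⟨ε₀, hε₀, fun ε h1 h2 => ?_⟩
    obtain ⟨k1, k2, k3⟩ := hsub ⟨h1, h2⟩
    rw [nearHamField_focusPert]
    refine ⟨fun i => loopSet (ε * 5) (ε * -21) (ε * -5) (x i ε).1 (x i ε).2.1 (x i ε).2.2, ?_,
      fun i => ⟨(k1 i).2, (k1 i).1.visitsAllZones, k2 i⟩⟩
    intro i j hij
    by_contra hne
    exact k3 i j hne ((k1 i).1.eq_of_loopSet_eq (k1 j).1 hij)
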